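/- All manifolds are smooth ($C^\infty$), Hausdorff and without boundary. Let $M$ be a $4$-manifold whose tangent bundle carries a filtration $T^1\subset T^2\subset T^3\subset T^4=TM$ by smooth subbundles with $\operatorname{rank} T^i=i$. For subbundles $S,T$ of $TM$ write $\Gamma(S)$ for the space of smooth sections of $S$ over $M$, and $[\Gamma(S),\Gamma(T)]$ for the $C^\infty(M)$-module of vector fields generated by the Lie brackets $[X,Y]$ with $X\in\Gamma(S)$, $Y\in\Gamma(T)$. Suppose that $$[\Gamma(T^1),\Gamma(T^2)]=[\Gamma(T^1),\Gamma(T^3)]=\Gamma(T^3),\qquad [\Gamma(T^3),\Gamma(T^3)]=\Gamma(T^4).\tag{$*$}$$ Let $J^2=\mathbb{R}^4$ be the space of $2$-jets of functions $y=y(x)$ of one variable, with coordinates $(x,y,p,q)$, let $\pi:J^2\to J^1$, $\pi(x,y,p,q)=(x,y,p)$, be the projection to the space $J^1=\mathbb{R}^3$ of $1$-jets, and let $\theta=dy-p\,dx$. The canonical filtration of $TJ^2$ consists of $T^1=\ker d\pi$, of the plane field $T^2$ of those vectors $v$ at $(x,y,p,q)$ for which $d\pi(v)$ is a multiple of $\partial_x+p\,\partial_y+q\,\partial_p$,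 of $T^3=\ker\pi^*\theta$, and of $T^4=TJ^2$. Call two filtered $4$-manifolds $M,N$ locally isomorphic if for all points $m\in M$, $n\in N$ there is a diffeomorphism $\Phi$ from an open neighbourhood of $m$ onto an open neighbourhood of $n$ with $\Phi(m)=n$ and $d\Phi(T^i_zM)=T^i_{\Phi(z)}N$ for all $z$ in the domain of $\Phi$ and $i=1,2,3,4$. Then $M$ is locally isomorphic to $J^2$ with its canonical filtration. Moreover, any two $4$-manifolds with filtrations satisfying $(*)$ are locally isomorphic. -/

import Mathlib

open scoped Manifold ContDiff Topology

noncomputable section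

/-- A field of tangent subspaces on a `4`-manifold. -/
abbrev TangentField (M : Type*) [TopologicalSpace M] [ChartedSpace (EuclideanSpace ℝ (Fin 4)) M] :
    Type _ :=
  (x : M) → Submodule ℝ (TangentSpace (𝓡 4) x)

/-- A (not necessarily smooth) vector field on a `4`-manifold. -/
abbrev VField (M : Type*) [TopologicalSpace M] [ChartedSpace (EuclideanSpace ℝ (Fin 4)) M] :
    Type _ :=
  (x : M) → TangentSpace (𝓡 4) x

section Manifold

variable {M : Type*} [TopologicalSpace M] [ChartedSpace (EuclideanSpace ℝ (Fin 4)) M]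
  [IsManifold (𝓡 4) ∞ M]

/-- The vector field `X` is smooth on the set `U`. -/
def SmoothVFieldOn (X : VField M) (U : Set M) : Prop :=
  ContMDiffOn (𝓡 4) (𝓡 4).tangent ∞ (fun x => (⟨x, X x⟩ : TangentBundle (𝓡 4) M)) U

/-- `T` is a smooth rank `k` subbundle of the tangent bundle: near every point it has a frame
consisting of `k` smooth vector fields. -/
def IsSmoothSubbundle (T : TangentField M) (k : ℕ) : Prop :=
  ∀ x : M, ∃ U : Set M, IsOpen U ∧ x ∈ U ∧ ∃ e : Fin k → VField M,
    (∀ i, SmoothVFieldOn (e i) U) ∧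
    ∀ y ∈ U, LinearIndependent ℝ (fun i => e i y) ∧
      Submodule.span ℝ (Set.range fun i => e i y) = T y

/-- `Γ(T)`: the smooth vector fields on `M` with values in `T`. -/
def smoothSections (T : TangentField M) : Set (VField M) :=
  {X | SmoothVFieldOn X Set.univ ∧ ∀ x, X x ∈ T x}

/-- `[Γ(S), Γ(T)]`: the module over the smooth functions that is generated by the Lie brackets
of a smooth section of `S` with a smooth section of `T`. -/
def bracketModule (S T : TangentField M) : Set (VField M) :=
  {Z | ∃ (n : ℕ) (f : Fin n → M → ℝ) (X Y : Fin n → VField M),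
    (∀ i, ContMDiff (𝓡 4) 𝓘(ℝ, ℝ) ∞ (f i)) ∧
    (∀ i, X i ∈ smoothSections S) ∧ (∀ i, Y i ∈ smoothSections T) ∧
    ∀ x, Z x = ∑ i, f i x • VectorField.mlieBracket (𝓡 4) (X i) (Y i) x}

end Manifold

/-- A filtration `T¹ ⊂ T² ⊂ T³ ⊂ T⁴ = TM` of the tangent bundle of a `4`-manifold by smooth
subbundles, `Tⁱ` being of rank `i`. -/
structure TangentFiltration (M : Type*) [TopologicalSpace M]
    [ChartedSpace (EuclideanSpace ℝ (Fin 4)) M] [IsManifold (𝓡 4) ∞ M] where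
  T1 : TangentField M
  T2 : TangentField M
  T3 : TangentField M
  smooth1 : IsSmoothSubbundle T1 1
  smooth2 : IsSmoothSubbundle T2 2
  smooth3 : IsSmoothSubbundle T3 3
  le12 : ∀ x, T1 x ≤ T2 x
  le23 : ∀ x, T2 x ≤ T3 x

namespace TangentFiltration

variable {M : Type*} [TopologicalSpace M] [ChartedSpace (EuclideanSpace ℝ (Fin 4)) M]
  [IsManifold (𝓡 4) ∞ M]
  {N : Type*} [TopologicalSpace N] [ChartedSpace (EuclideanSpace ℝ (Fin 4)) N]
  [IsManifold (𝓡 4) ∞ N]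

/-- The top level `T⁴ = TM` of a filtration. -/
def T4 (_F : TangentFiltration M) : TangentField M := fun _ => ⊤

/-- `[Γ(T¹), Γ(T²)] = [Γ(T¹), Γ(T³)] = Γ(T³)` and `[Γ(T³), Γ(T³)] = Γ(T⁴)`. -/
structure BracketConditions (F : TangentFiltration M) : Prop where
  bracket12 : bracketModule F.T1 F.T2 = smoothSections F.T3
  bracket13 : bracketModule F.T1 F.T3 = smoothSections F.T3
  bracket33 : bracketModule F.T3 F.T3 = smoothSections F.T4

/-- Some diffeomorphism from an open neighbourhood of `x` onto an open neighbourhood of `y`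
takes `x` to `y` and the first filtration to the second. -/
def LocallyIsomorphicAt (F : TangentFiltration M) (G : TangentFiltration N) (x : M) (y : N) :
    Prop :=
  ∃ Φ : PartialDiffeomorph (𝓡 4) (𝓡 4) M N ∞, x ∈ Φ.source ∧ Φ x = y ∧
    ∀ z ∈ Φ.source,
      (F.T1 z).map (mfderiv (𝓡 4) (𝓡 4) Φ z).toLinearMap = G.T1 (Φ z) ∧
      (F.T2 z).map (mfderiv (𝓡 4) (𝓡 4) Φ z).toLinearMap = G.T2 (Φ z) ∧
      (F.T3 z).map (mfderiv (𝓡 4) (𝓡 4) Φ z).toLinearMap = G.T3 (Φ z) ∧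
      (F.T4 z).map (mfderiv (𝓡 4) (𝓡 4) Φ z).toLinearMap = G.T4 (Φ z)

/-- Every point of the first manifold and every point of the second one have isomorphic
neighbourhoods. -/
def LocallyIsomorphic (F : TangentFiltration M) (G : TangentFiltration N) : Prop :=
  ∀ (x : M) (y : N), LocallyIsomorphicAt F G x y

end TangentFiltration

/-! ### The jet spaces of functions `y = y(x)` -/

/-- The space of `1`-jets, with its coordinates `(x, y, p)`. -/
abbrev JetOne : Type := EuclideanSpace ℝ (Fin 3)

/-- The space of `2`-jets, with its coordinates `(x, y, p, q)`. -/
abbrev JetTwo : Type := EuclideanSpace ℝ (Fin 4)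

namespace JetTwo

/-- The fibration `π : J² → J¹`, `(x, y, p, q) ↦ (x, y, p)`. -/
def proj (z : JetTwo) : JetOne := !₂[z 0, z 1, z 2]

/-- The contact form `θ = dy - p dx` of `J¹` at the point `w = (x, y, p)`. -/
def contactForm (w : JetOne) : EuclideanSpace ℝ (Fin 3) →ₗ[ℝ] ℝ where
  toFun v := v 1 - w 2 * v 0
  map_add' u v := by simp; ring
  map_smul' c v := by simp; ring

/-- The point `(x, y, p, q)` of `J²` as a direction at the point `(x, y, p)` of `J¹`: the line
spanned by `∂/∂x + p ∂/∂y + q ∂/∂p`. -/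
def direction (z : JetTwo) : Submodule ℝ (EuclideanSpace ℝ (Fin 3)) :=
  Submodule.span ℝ {!₂[1, z 2, z 3]}

/-- The differential of `π : J² → J¹`. -/
def dproj (z : JetTwo) : TangentSpace (𝓡 4) z →ₗ[ℝ] EuclideanSpace ℝ (Fin 3) :=
  (mfderiv (𝓡 4) (𝓡 3) proj z).toLinearMap

/-- The vertical line field of `π : J² → J¹`. -/
def vertical : TangentField JetTwo := fun z => LinearMap.ker (dproj z)

/-- The tautological `2`-plane field: the vectors `v` for which `π_* v` lies in the direction
given by the point. -/
def tautological : TangentField JetTwo := fun z => (direction z).comap (dproj z)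

/-- The annihilator of the pullback of the contact form. -/
def contact : TangentField JetTwo := fun z =>
  LinearMap.ker ((contactForm (proj z)).comp (dproj z))

theorem hasFDerivAt_proj (z : JetTwo) :
    ∃ L : JetTwo →L[ℝ] JetOne, HasFDerivAt proj L z ∧ ∀ v, L v = !₂[v 0, v 1, v 2] := by
  let L : JetTwo →ₗ[ℝ] JetOne :=
    { toFun := fun v => !₂[v 0, v 1, v 2]
      map_add' := by intro u v; ext i; fin_cases i <;> simp
      map_smul' := by intro c v; ext i; fin_cases i <;> simp }
  exact ⟨LinearMap.toContinuousLinearMap L,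
    (LinearMap.toContinuousLinearMap L).hasFDerivAt, fun _ => rfl⟩

theorem dproj_apply (z v : JetTwo) : dproj z v = !₂[v 0, v 1, v 2] := by
  obtain ⟨L, hL, hv⟩ := hasFDerivAt_proj z
  have h : mfderiv (𝓡 4) (𝓡 3) proj z = L := by
    rw [mfderiv_eq_fderiv]; exact hL.fderiv
  change mfderiv (𝓡 4) (𝓡 3) proj z v = _
  rw [h]; exact hv v

theorem mem_vertical (z v : JetTwo) : v ∈ vertical z ↔ v 0 = 0 ∧ v 1 = 0 ∧ v 2 = 0 := by
  change dproj z v = 0 ↔ _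
  rw [dproj_apply]
  constructor
  · intro h
    exact ⟨by simpa using congrArg (fun w : JetOne => w 0) h,
      by simpa using congrArg (fun w : JetOne => w 1) h,
      by simpa using congrArg (fun w : JetOne => w 2) h⟩
  · rintro ⟨h0, h1, h2⟩
    ext i; fin_cases i <;> simp [h0, h1, h2]

theorem mem_tautological (z v : JetTwo) :
    v ∈ tautological z ↔ v 1 = z 2 * v 0 ∧ v 2 = z 3 * v 0 := by
  change dproj z v ∈ direction z ↔ _
  rw [dproj_apply, direction, Submodule.mem_span_singleton]
  constructor
  · rintro ⟨a, h⟩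
    have h0 : a = v 0 := by simpa using congrArg (fun w : JetOne => w 0) h
    have h1 : a * z 2 = v 1 := by simpa using congrArg (fun w : JetOne => w 1) h
    have h2 : a * z 3 = v 2 := by simpa using congrArg (fun w : JetOne => w 2) h
    subst h0
    exact ⟨by rw [← h1, mul_comm], by rw [← h2, mul_comm]⟩
  · rintro ⟨h1, h2⟩
    refine ⟨v 0, ?_⟩
    ext i; fin_cases i <;> simp [h1, h2, mul_comm]

theorem mem_contact (z v : JetTwo) : v ∈ contact z ↔ v 1 = z 2 * v 0 := by
  change contactForm (proj z) (dproj z v) = 0 ↔ _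
  rw [dproj_apply]
  simp [contactForm, proj, sub_eq_zero]

theorem smoothVFieldOn_of_contDiff (X : JetTwo → JetTwo) (h : ContDiff ℝ ∞ X) (U : Set JetTwo) :
    SmoothVFieldOn (M := JetTwo) X U := by
  have := (contMDiff_vectorSpace_iff_contDiff (𝕜 := ℝ) (n := ∞) (V := X)).2 h
  exact this.contMDiffOn

/-- The coordinate fields `∂/∂q`, `∂/∂x + p ∂/∂y + q ∂/∂p`, `∂/∂p` on `J²`. -/
def frame : Fin 3 → JetTwo → JetTwo :=
  ![fun _ => !₂[0, 0, 0, 1], fun z => !₂[1, z 2, z 3, 0], fun _ => !₂[0, 0, 1, 0]]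

theorem frame_smooth (i : Fin 3) : ContDiff ℝ ∞ (frame i) := by
  rw [contDiff_euclidean]
  intro j
  fin_cases i <;> fin_cases j <;> simp [frame] <;> fun_prop

theorem isSmoothSubbundle_of_frame (T : TangentField JetTwo) {k : ℕ}
    (e : Fin k → JetTwo → JetTwo) (he : ∀ i, ContDiff ℝ ∞ (e i))
    (hli : ∀ (y : JetTwo) (c : Fin k → ℝ), ∑ i, c i • e i y = 0 → ∀ i, c i = 0)
    (hT : ∀ y v : JetTwo, v ∈ T y ↔ ∃ c : Fin k → ℝ, ∑ i, c i • e i y = v) :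
    IsSmoothSubbundle T k := by
  have h1 : ∀ y, LinearIndependent ℝ (fun i => e i y) := fun y =>
    Fintype.linearIndependent_iff.2 (hli y)
  have h2 : ∀ y, Submodule.span ℝ (Set.range fun i => e i y) = (T y : Submodule ℝ JetTwo) := by
    intro y
    apply Submodule.ext
    intro v
    exact (Submodule.mem_span_range_iff_exists_fun ℝ).trans (hT y v).symm
  exact fun x => ⟨Set.univ, isOpen_univ, trivial, e,
    fun i => smoothVFieldOn_of_contDiff _ (he i) _, fun y _ => ⟨h1 y, h2 y⟩⟩

theorem smooth_vertical : IsSmoothSubbundle vertical 1 := by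
  refine isSmoothSubbundle_of_frame _ (fun _ => frame 0) (fun _ => frame_smooth 0) ?_ ?_
  · intro y c hc i
    have h3 := congrArg (fun w : JetTwo => w 3) hc
    simp [frame] at h3
    rw [Subsingleton.elim i 0]; exact h3
  · intro y v
    rw [mem_vertical]
    constructor
    · rintro ⟨h0, h1, h2⟩
      refine ⟨fun _ => v 3, ?_⟩
      ext j
      fin_cases j <;> simp [frame, h0, h1, h2]
    · rintro ⟨c, rfl⟩
      simp [frame]

theorem smooth_tautological : IsSmoothSubbundle tautological 2 := by
  refine isSmoothSubbundle_of_frame _ (fun i => frame i.castSucc) (fun i => frame_smooth _) ?_ ?_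
  · intro y c hc i
    have h0 := congrArg (fun w : JetTwo => w 0) hc
    have h3 := congrArg (fun w : JetTwo => w 3) hc
    simp [frame, Fin.sum_univ_two] at h0 h3
    fin_cases i
    exacts [h3, h0]
  · intro y v
    rw [mem_tautological]
    constructor
    · rintro ⟨h1, h2⟩
      refine ⟨![v 3, v 0], ?_⟩
      ext j
      fin_cases j <;> simp [frame, Fin.sum_univ_two, h1, h2, mul_comm]
    · rintro ⟨c, rfl⟩
      simp [frame, Fin.sum_univ_two, mul_comm]

theorem smooth_contact : IsSmoothSubbundle contact 3 := by
  refine isSmoothSubbundle_of_frame _ frame frame_smooth ?_ ?_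
  · intro y c hc i
    have h0 := congrArg (fun w : JetTwo => w 0) hc
    have h2 := congrArg (fun w : JetTwo => w 2) hc
    have h3 := congrArg (fun w : JetTwo => w 3) hc
    simp [frame, Fin.sum_univ_three] at h0 h2 h3
    simp [h0] at h2
    fin_cases i
    exacts [h3, h0, h2]
  · intro y v
    rw [mem_contact]
    constructor
    · intro h1
      refine ⟨![v 3, v 0, v 2 - v 0 * y 3], ?_⟩
      ext j
      fin_cases j <;> simp [frame, Fin.sum_univ_three, h1, mul_comm]
    · rintro ⟨c, rfl⟩
      simp [frame, Fin.sum_univ_three, mul_comm]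

/-- The canonical filtration of the tangent bundle of `J²`. -/
def canonicalFiltration : TangentFiltration JetTwo where
  T1 := vertical
  T2 := tautological
  T3 := contact
  smooth1 := smooth_vertical
  smooth2 := smooth_tautological
  smooth3 := smooth_contact
  le12 z v hv := by
    obtain ⟨h0, h1, h2⟩ := (mem_vertical z v).1 hv
    exact (mem_tautological z v).2 (by simp [h0, h1, h2])
  le23 z v hv := (mem_contact z v).2 ((mem_tautological z v).1 hv).1

end JetTwo

end

/-! This is Engel's normal form. Let `e 0`, `e 1`, `e 2` be a local frame adapted to T¹ ⊂ T² ⊂ T³,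
and α a form with kernel T³. Since [T¹, T²] and [T¹, T³] lie in T³, `e 0` is a Cauchy characteristic
of α, that is, its flow preserves T³. So T³ descends to a plane field on the local quotient by this
flow. Any line field in that plane field has two independent first integrals; pulled back, they are
functions x, y for which dx = dy = 0 cuts out a rank 2 distribution inside T³ containing `e 0`
(`exists_first_integrals`). The line field is chosen so that dx(`e 1`) ≠ 0. Then T³ is the kernel of
dy - p dx with p = dy(`e 1`)/dx(`e 1`), and one puts q = dp(`e 1`)/dx(`e 1`).

The formula `contact_lieBracket` for contact forms gives the rest (`exists_isEngelChart`). From [`e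
0`, `e 1`] ∈ T³ follows dp(`e 0`) = 0; from [`e 1`, `e 2`] ∉ T³ follows that dp - q dx does not
vanish on `e 2`; from [`e 0`, `e 1`] ∉ T² follows dq(`e 0`) ≠ 0. Hence (x, y, p, q) are coordinates,
and they carry the flag to the canonical one.

The hypotheses concern modules of global sections. A form that vanished at a point on all frame
brackets would vanish there on the whole bracket module (`form_bracketModule_eq_zero`), which
contains a section on which the form is 1; this yields the two pointwise non-memberships. Adding a
quadratic polynomial in x to y moves the chart to any prescribed point of J²
(`IsEngelChart.exists_shift`), so two manifolds can be compared through J².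

The straightening of vector fields rests on flows that are smooth in the initial value. These come
from the inverse function theorem in the Banach space of continuous curves on [-1, 1]. -/

/-! ### Composition operators and smooth dependence of flows on initial values -/

section Nemytskii

universe u

variable {K : Type*} [TopologicalSpace K] [CompactSpace K]
  {E F : Type u} [NormedAddCommGroup E] [NormedSpace ℝ E] [NormedAddCommGroup F] [NormedSpace ℝ F]

/-- Pointwise application, as a continuous bilinear map on spaces of continuous functions. -/
noncomputable def ContinuousMap.pointwiseApply (K E F : Type*) [TopologicalSpace K] [CompactSpace K]
    [NormedAddCommGroup E] [NormedSpace ℝ E] [NormedAddCommGroup F] [NormedSpace ℝ F] :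
    C(K, E →L[ℝ] F) →L[ℝ] C(K, E) →L[ℝ] C(K, F) :=
  LinearMap.mkContinuous₂
    (LinearMap.mk₂ ℝ (fun (A : C(K, E →L[ℝ] F)) (h : C(K, E)) =>
        (⟨fun t => A t (h t), A.continuous.clm_apply h.continuous⟩ : C(K, F)))
      (fun _ _ _ => by ext; simp) (fun _ _ _ => by ext; simp)
      (fun _ _ _ => by ext; simp) (fun _ _ _ => by ext; simp)) 1
    (fun A h => by
      rw [one_mul, ContinuousMap.norm_le _ (by positivity)]
      intro t
      exact (A t).le_of_opNorm_le_of_le (A.norm_coe_le_norm t) (h.norm_coe_le_norm t))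

@[simp]
theorem ContinuousMap.pointwiseApply_apply (A : C(K, E →L[ℝ] F)) (h : C(K, E)) (t : K) :
    ContinuousMap.pointwiseApply K E F A h t = A t (h t) := rfl

/-- The composition operator `γ ↦ f ∘ γ`. -/
def ContinuousMap.superpose (f : C(E, F)) (γ : C(K, E)) : C(K, F) := f.comp γ

/-- The mean value inequality at each time t, with an error bound uniform in t because composition
with `f'` is continuous in the sup norm. -/
theorem ContinuousMap.hasFDerivAt_superpose (f : C(E, F)) (f' : C(E, E →L[ℝ] F))
    (hf : ∀ x, HasFDerivAt f (f' x) x) (γ : C(K, E)) :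
    HasFDerivAt (ContinuousMap.superpose (K := K) f)
      (ContinuousMap.pointwiseApply K E F (ContinuousMap.superpose f' γ)) γ := by
  rw [hasFDerivAt_iff_isLittleO_nhds_zero, Asymptotics.isLittleO_iff]
  intro c hc
  have hcont : Continuous (ContinuousMap.superpose (K := K) f') :=
    ContinuousMap.continuous_postcomp f'
  obtain ⟨δ, hδ, hδ'⟩ := Metric.continuous_iff.1 hcont γ c hc
  filter_upwards [Metric.ball_mem_nhds (0 : C(K, E)) hδ] with h hh
  rw [ContinuousMap.norm_le _ (by positivity)]
  intro t
  have hh' : ‖h‖ < δ := by simpa using hh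
  -- Translating γ by a constant makes it pass through `y` at time `t`. Continuity of composition
  -- with `f'` then gives the bound with δ independent of `t`.
  have hb : ∀ y ∈ Metric.ball (γ t) δ, ‖f' y - f' (γ t)‖ ≤ c := by
    intro y hy
    have h1 : dist (γ + ContinuousMap.const K (y - γ t)) γ < δ := by
      rw [dist_eq_norm, add_sub_cancel_left]
      refine lt_of_le_of_lt ?_ (by simpa [dist_eq_norm] using hy : ‖y - γ t‖ < δ)
      rw [ContinuousMap.norm_le _ (by positivity)]
      intro s; simp
    have h2 := (hδ' _ h1).le
    rw [ContinuousMap.dist_le hc.le] at h2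
    have h3 := h2 t
    simpa [ContinuousMap.superpose, dist_eq_norm] using h3
  have h4 : γ t + h t ∈ Metric.ball (γ t) δ := by
    simpa using lt_of_le_of_lt (h.norm_coe_le_norm t) hh'
  have h5 := (convex_ball (γ t) δ).norm_image_sub_le_of_norm_hasFDerivWithin_le'
    (fun x _ => (hf x).hasFDerivWithinAt) hb (Metric.mem_ball_self hδ) h4
  rw [add_sub_cancel_left] at h5
  refine le_trans ?_ (h5.trans (mul_le_mul_of_nonneg_left (h.norm_coe_le_norm t) hc.le))
  simp [ContinuousMap.superpose]

/-- The derivative is again a composition operator, with `f'`, followed by a bounded linear map, so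
induction on `n` applies. The target varies in the induction; `E` and `F` share a universe so that
it also contains `E →L[ℝ] F`. -/
theorem ContinuousMap.contDiff_nat_superpose (n : ℕ) : ∀ {F : Type u} [NormedAddCommGroup F]
    [NormedSpace ℝ F] (f : C(E, F)), ContDiff ℝ n f →
    ContDiff ℝ n (ContinuousMap.superpose (K := K) f) := by
  induction n with
  | zero =>
    intro F _ _ f _
    exact contDiff_zero.2 (ContinuousMap.continuous_postcomp f)
  | succ n ih =>
    intro F _ _ f hf
    have hf1 := contDiff_succ_iff_hasFDerivAt.1 (by exact_mod_cast hf)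
    obtain ⟨f', hf', hd⟩ := hf1
    have := ih ⟨f', hf'.continuous⟩ hf'
    push_cast
    exact contDiff_succ_iff_hasFDerivAt.2
      ⟨_, (ContinuousMap.pointwiseApply K E F).contDiff.comp this,
        ContinuousMap.hasFDerivAt_superpose f ⟨f', hf'.continuous⟩ hd⟩

theorem ContinuousMap.contDiff_superpose (f : C(E, F)) (hf : ContDiff ℝ ∞ f) :
    ContDiff ℝ ∞ (ContinuousMap.superpose (K := K) f) :=
  contDiff_infty.2 fun n => ContinuousMap.contDiff_nat_superpose n f (contDiff_infty.1 hf n)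

end Nemytskii

/-! ### Curves on [-1, 1]: rescaling of time and primitives. -/

section Primitive

variable {E : Type*} [NormedAddCommGroup E]

/-- The time interval `[-1, 1]`. -/
abbrev UnitTime : Type := Set.Icc (-1 : ℝ) 1

theorem UnitTime.le : (-1 : ℝ) ≤ 1 := by norm_num

/-- Extension of a curve on `[-1, 1]` to a continuous curve on the line. -/
noncomputable def timeExtend (γ : C(UnitTime, E)) (s : ℝ) : E :=
  γ (Set.projIcc (-1) 1 UnitTime.le s)

theorem continuous_timeExtend (γ : C(UnitTime, E)) : Continuous (timeExtend γ) :=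
  γ.continuous.comp continuous_projIcc

theorem norm_timeExtend_le (γ : C(UnitTime, E)) (s : ℝ) : ‖timeExtend γ s‖ ≤ ‖γ‖ :=
  γ.norm_coe_le_norm _

theorem timeExtend_coe (γ : C(UnitTime, E)) (t : UnitTime) : timeExtend γ t = γ t := by
  simp [timeExtend]

/-- Contraction of time by the factor `r ∈ [-1, 1]`. -/
def timeScale (r : UnitTime) (γ : C(UnitTime, E)) : C(UnitTime, E) :=
  γ.comp ⟨fun t => ⟨r * t, by
    have h := abs_le.2 r.2
    have h' := abs_le.2 t.2
    rw [Set.mem_Icc, ← abs_le, abs_mul]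
    exact mul_le_one₀ h (abs_nonneg _) h'⟩, by fun_prop⟩

theorem timeScale_apply (r : UnitTime) (γ : C(UnitTime, E)) (t : UnitTime) :
    timeScale r γ t = timeExtend γ (r * t) := by
  rw [timeExtend, Set.projIcc_of_mem]; rfl

variable [NormedSpace ℝ E] [CompleteSpace E]

/-- The primitive vanishing at time `0`. -/
noncomputable def timePrimitive (E : Type*) [NormedAddCommGroup E] [NormedSpace ℝ E]
    [CompleteSpace E] : C(UnitTime, E) →L[ℝ] C(UnitTime, E) :=
  LinearMap.mkContinuous
    { toFun := fun γ => ⟨fun t => ∫ s in (0 : ℝ)..t, timeExtend γ s,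
        (intervalIntegral.continuous_primitive
          (fun a b => (continuous_timeExtend γ).intervalIntegrable a b) 0).comp
          continuous_subtype_val⟩
      map_add' := fun γ η => by
        ext t
        exact intervalIntegral.integral_add ((continuous_timeExtend γ).intervalIntegrable _ _)
          ((continuous_timeExtend η).intervalIntegrable _ _)
      map_smul' := fun c γ => by
        ext t
        exact intervalIntegral.integral_smul c (timeExtend γ) } 1
    (fun γ => by
      rw [one_mul, ContinuousMap.norm_le _ (norm_nonneg _)]
      intro t
      refine (intervalIntegral.norm_integral_le_of_norm_le_const
        (fun s _ => norm_timeExtend_le γ s)).trans ?_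
      refine mul_le_of_le_one_right (norm_nonneg _) ?_
      rw [sub_zero, abs_le]
      exact t.2)

theorem timePrimitive_apply (γ : C(UnitTime, E)) (t : UnitTime) :
    timePrimitive E γ t = ∫ s in (0 : ℝ)..t, timeExtend γ s := rfl

/-- The substitution s ↦ r s in the integral. It shows that slowing down a solution of γ' = s f(γ)
by the factor r gives a solution with parameter r s. -/
theorem timePrimitive_timeScale (r : UnitTime) (γ : C(UnitTime, E)) :
    (r : ℝ) • timePrimitive E (timeScale r γ) = timeScale r (timePrimitive E γ) := by
  ext t
  have h1 : timeScale r (timePrimitive E γ) t = ∫ s in (0 : ℝ)..(r * t), timeExtend γ s := rfl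
  rw [ContinuousMap.smul_apply, h1, timePrimitive_apply]
  have h2 : ∀ s ∈ Set.uIcc (0 : ℝ) t, timeExtend (timeScale r γ) s = timeExtend γ (r * s) := by
    intro s hs
    have hs' : s ∈ Set.Icc (-1 : ℝ) 1 := by
      have h0 : (0 : ℝ) ∈ Set.Icc (-1 : ℝ) 1 := by constructor <;> norm_num
      exact (Set.ordConnected_Icc.uIcc_subset h0 t.2) hs
    have h3 := timeExtend_coe (timeScale r γ) ⟨s, hs'⟩
    rw [timeScale_apply] at h3
    exact h3
  rw [intervalIntegral.integral_congr h2, intervalIntegral.smul_integral_comp_mul_left, mul_zero]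

end Primitive

/-! ### Smooth local flows by the inverse function theorem. -/

section Flow

/-- Inverse function theorem, with the source shrunk to an open set on which `f` is smooth with
invertible derivative. The inverse is then smooth on the whole target and not merely at the image of
`a`. -/
theorem exists_smooth_localInverse {E F : Type*} [NormedAddCommGroup E] [NormedSpace ℝ E]
    [CompleteSpace E] [NormedAddCommGroup F] [NormedSpace ℝ F] {f : E → F} {a : E}
    (hf : ∀ᶠ x in 𝓝 a, ContDiffAt ℝ ∞ f x) {f' : E ≃L[ℝ] F}
    (hf' : HasFDerivAt f (f' : E →L[ℝ] F) a) :
    ∃ g : OpenPartialHomeomorph E F, a ∈ g.source ∧ (∀ x, g x = f x) ∧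
      (∀ x ∈ g.source, ContDiffAt ℝ ∞ f x) ∧
      (∀ x ∈ g.source, ∃ A : E ≃L[ℝ] F, HasFDerivAt f (A : E →L[ℝ] F) x) ∧
      ∀ y ∈ g.target, ContDiffAt ℝ ∞ g.symm y := by
  have h0 := hf.self_of_nhds
  have hn : (∞ : WithTop ℕ∞) ≠ 0 := by simp
  have h1 : ∀ᶠ x in 𝓝 a, ∃ A : E ≃L[ℝ] F, (A : E →L[ℝ] F) = fderiv ℝ f x := by
    have hc : ContinuousAt (fderiv ℝ f) a := (h0.fderiv_right (m := 0) (by simp)).continuousAt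
    have := f'.nhds
    rw [← hf'.fderiv] at this
    exact hc this
  obtain ⟨U, hU, hUo, haU⟩ := eventually_nhds_iff.1 (hf.and h1)
  let h := (h0.toOpenPartialHomeomorph f hf' hn).restrOpen U hUo
  have hsU : ∀ x ∈ h.source, x ∈ U := fun x hx => hx.2
  have hd : ∀ x ∈ h.source, ∃ A : E ≃L[ℝ] F, HasFDerivAt f (A : E →L[ℝ] F) x := by
    intro x hx
    obtain ⟨h2, A, hA⟩ := hU x (hsU x hx)
    exact ⟨A, hA ▸ (h2.differentiableAt hn).hasFDerivAt⟩
  refine ⟨h, ⟨h0.mem_toOpenPartialHomeomorph_source hf' hn, haU⟩, fun x => rfl,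
    fun x hx => (hU x (hsU x hx)).1, hd, fun y hy => ?_⟩
  obtain ⟨A, hA⟩ := hd _ (h.map_target hy)
  exact h.contDiffAt_symm hy hA (hU _ (hsU _ (h.map_target hy))).1

variable {E : Type*} [NormedAddCommGroup E] [NormedSpace ℝ E]

/-- The constant curves. -/
noncomputable def constCurve (E : Type*) [NormedAddCommGroup E] [NormedSpace ℝ E] :
    E →L[ℝ] C(UnitTime, E) :=
  ContinuousLinearMap.const ℝ UnitTime

@[simp]
theorem constCurve_apply (x : E) (t : UnitTime) : constCurve E x t = x := rfl

variable [CompleteSpace E]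

/-- The map whose zeros in the last factor are the curves with `γ' = s • f γ`, `γ 0 = x`. -/
noncomputable def flowEquation (f : C(E, E)) (p : (E × ℝ) × C(UnitTime, E)) :
    (E × ℝ) × C(UnitTime, E) :=
  (p.1, p.2 - constCurve E p.1.1
    - p.1.2 • timePrimitive E (ContinuousMap.superpose f p.2))

theorem contDiff_flowEquation (f : C(E, E)) (hf : ContDiff ℝ ∞ f) :
    ContDiff ℝ ∞ (flowEquation f) := by
  refine contDiff_fst.prodMk ((contDiff_snd.sub ?_).sub ?_)
  · exact (constCurve E).contDiff.comp (contDiff_fst.comp contDiff_fst)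
  · exact (contDiff_snd.comp contDiff_fst).smul ((timePrimitive E).contDiff.comp
      ((ContinuousMap.contDiff_superpose f hf).comp contDiff_snd))

/-- At parameter s = 0 the factor s removes the derivative of the nonlinear term in the direction of
the curve. What remains is block triangular with identities on the diagonal, hence invertible. -/
theorem hasFDerivAt_flowEquation (f : C(E, E)) (hf : ContDiff ℝ ∞ f) (m : E) (γ : C(UnitTime, E)) :
    ∃ A : ((E × ℝ) × C(UnitTime, E)) ≃L[ℝ] (E × ℝ) × C(UnitTime, E),
      HasFDerivAt (flowEquation f) (A : _ →L[ℝ] (E × ℝ) × C(UnitTime, E)) ((m, 0), γ) := by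
  let κ : C(UnitTime, E) := timePrimitive E (ContinuousMap.superpose f γ)
  let S : E × ℝ →L[ℝ] C(UnitTime, E) :=
    -((constCurve E).comp (ContinuousLinearMap.fst ℝ E ℝ))
      - (ContinuousLinearMap.snd ℝ E ℝ).smulRight κ
  refine ⟨(ContinuousLinearEquiv.refl ℝ _).skewProd (ContinuousLinearEquiv.refl ℝ _) S, ?_⟩
  have h1 : HasFDerivAt (fun p : (E × ℝ) × C(UnitTime, E) =>
      timePrimitive E (ContinuousMap.superpose f p.2)) (fderiv ℝ (fun p : (E × ℝ) × C(UnitTime, E) =>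
      timePrimitive E (ContinuousMap.superpose f p.2)) ((m, 0), γ)) ((m, 0), γ) := by
    refine DifferentiableAt.hasFDerivAt (ContDiff.differentiable (n := ∞) ?_ (by simp) _)
    exact (timePrimitive E).contDiff.comp
      ((ContinuousMap.contDiff_superpose f hf).comp contDiff_snd)
  have h2 : HasFDerivAt (fun p : (E × ℝ) × C(UnitTime, E) => p.1.2)
      ((ContinuousLinearMap.snd ℝ E ℝ).comp (ContinuousLinearMap.fst ℝ _ _)) ((m, 0), γ) :=
    hasFDerivAt_snd.comp _ hasFDerivAt_fst
  have h3 : HasFDerivAt (fun p : (E × ℝ) × C(UnitTime, E) =>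
      constCurve E p.1.1)
      ((constCurve E).comp ((ContinuousLinearMap.fst ℝ E ℝ).comp
        (ContinuousLinearMap.fst ℝ _ _))) ((m, 0), γ) :=
    (constCurve E).hasFDerivAt.comp _ (hasFDerivAt_fst.comp _ hasFDerivAt_fst)
  have h4 := HasFDerivAt.prodMk (hasFDerivAt_fst (𝕜 := ℝ) (p := ((m, (0 : ℝ)), γ)))
    ((hasFDerivAt_snd.sub h3).sub (h2.smul h1))
  refine h4.congr_fderiv ?_
  ext p <;> simp [S, κ, sub_eq_add_neg]

/-- A smooth vector field has a smooth local flow. -/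
theorem exists_smooth_flow (f : E → E) (hf : ContDiff ℝ ∞ f) (m : E) :
    ∃ φ : E × ℝ → E, (∀ᶠ p in 𝓝 (m, (0 : ℝ)), ContDiffAt ℝ ∞ φ p) ∧
      (∀ᶠ x in 𝓝 m, φ (x, 0) = x) ∧
      ∀ᶠ p in 𝓝 (m, (0 : ℝ)), HasDerivAt (fun s => φ (p.1, s)) (f (φ p)) p.2 := by
  let F : C(E, E) := ⟨f, hf.continuous⟩
  let c : E → C(UnitTime, E) := constCurve E
  have hcc : ∀ x t, c x t = x := fun x t => rfl
  obtain ⟨A, hA⟩ := hasFDerivAt_flowEquation F hf m (c m)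
  have hG := contDiff_flowEquation F hf
  obtain ⟨g, ha, hgG, -, -, hgs⟩ := exists_smooth_localInverse
    (Filter.Eventually.of_forall fun x => hG.contDiffAt) hA
  have hGa : flowEquation F ((m, 0), c m) = ((m, 0), 0) := by
    simp [flowEquation, c]
  have ha' : ((m, (0 : ℝ)), (0 : C(UnitTime, E))) ∈ g.target := by
    rw [← hGa, ← hgG]; exact g.map_source ha
  have hga : g.symm ((m, (0 : ℝ)), (0 : C(UnitTime, E))) = ((m, 0), c m) := by
    rw [← hGa, ← hgG]; exact g.left_inv ha
  -- `Γ (x, s)` solves γ' = s f(γ), γ(0) = x; the flow will be its value at time 1.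
  let Γ : E × ℝ → C(UnitTime, E) := fun p => (g.symm (p, 0)).2
  have htend : Filter.Tendsto (fun p : E × ℝ => (p, (0 : C(UnitTime, E)))) (𝓝 (m, 0))
      (𝓝 ((m, (0 : ℝ)), 0)) := by
    apply Continuous.tendsto' <;> [fun_prop; rfl]
  have htar : ∀ᶠ p in 𝓝 (m, (0 : ℝ)), (p, (0 : C(UnitTime, E))) ∈ g.target :=
    htend (g.open_target.mem_nhds ha')
  have hΓs : ∀ p : E × ℝ, (p, (0 : C(UnitTime, E))) ∈ g.target → ContDiffAt ℝ ∞ Γ p := by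
    intro p hp
    exact contDiffAt_snd.comp p ((hgs _ hp).comp p (contDiffAt_id.prodMk contDiffAt_const))
  have hsol : ∀ p : E × ℝ, (p, (0 : C(UnitTime, E))) ∈ g.target →
      Γ p = c p.1 + p.2 • timePrimitive E (ContinuousMap.superpose F (Γ p)) := by
    intro p hp
    have h := g.right_inv hp
    rw [hgG] at h
    have h1 : (g.symm (p, 0)).1 = p := congrArg Prod.fst h
    have h2 := congrArg Prod.snd h
    simp only [flowEquation, h1] at h2
    rw [sub_sub, sub_eq_zero] at h2
    exact h2
  have huniq : ∀ (p : E × ℝ) (γ : C(UnitTime, E)), (p, γ) ∈ g.source →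
      γ = c p.1 + p.2 • timePrimitive E (ContinuousMap.superpose F γ) → γ = Γ p := by
    intro p γ hp h
    have h1 : g (p, γ) = (p, 0) := by
      rw [hgG]
      simp only [flowEquation, Prod.mk.injEq, true_and]
      rw [sub_sub, sub_eq_zero]
      exact h
    have := g.left_inv hp
    rw [h1] at this
    exact (congrArg Prod.snd this).symm
  obtain ⟨ε, hε, hball⟩ := Metric.mem_nhds_iff.1 (g.open_source.mem_nhds ha)
  have hΓm : Γ (m, 0) = c m := congrArg Prod.snd hga
  have hΓε : ∀ᶠ p in 𝓝 (m, (0 : ℝ)), dist (Γ p) (c m) < ε := by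
    have := (hΓs _ ha').continuousAt
    rw [← hΓm]
    exact this (Metric.ball_mem_nhds _ hε)
  obtain ⟨δ, hδ, hδ'⟩ := Metric.eventually_nhds_iff.1 (htar.and hΓε)
  -- Below δ, so that the curve for parameter `s₁` exists and is ε-close to the constant one; below
  -- ε, so that its rescalings stay in the ball where `huniq` applies.
  let s₁ : ℝ := min δ ε / 2
  have hs₁ : 0 < s₁ := by positivity
  have hs₁δ : s₁ < δ := (half_lt_self (lt_min hδ hε)).trans_le (min_le_left _ _)
  have hs₁ε : s₁ < ε := (half_lt_self (lt_min hδ hε)).trans_le (min_le_right _ _)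
  have hdist : ∀ x s, dist x m < s₁ → |s| ≤ s₁ → dist (x, s) (m, (0 : ℝ)) < δ := by
    intro x s hx hs
    rw [Prod.dist_eq]
    exact max_lt (hx.trans hs₁δ) (by simpa using hs.trans_lt hs₁δ)
  -- The rescaled curve solves the equation with parameter `r * s₁`, so it is `Γ` there by local
  -- injectivity. Thus s ↦ `Γ (x, s) e` runs along the single curve `Γ (x, s₁)`, and the
  -- differential equation in s can be read off from it.
  have hscale : ∀ x, dist x m < s₁ → ∀ r : UnitTime, Γ (x, r * s₁) = timeScale r (Γ (x, s₁)) := by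
    intro x hx r
    have hr := abs_le.2 r.2
    obtain ⟨h1, h2⟩ := hδ' (hdist x s₁ hx (abs_of_pos hs₁).le)
    have hr' : |(r : ℝ) * s₁| ≤ s₁ := by
      rw [abs_mul, abs_of_pos hs₁]; exact mul_le_of_le_one_left hs₁.le hr
    symm
    apply huniq
    · apply hball
      rw [Metric.mem_ball, Prod.dist_eq, Prod.dist_eq]
      refine max_lt (max_lt (hx.trans hs₁ε) (by simpa using hr'.trans_lt hs₁ε)) ?_
      rw [ContinuousMap.dist_lt_iff hε]
      intro t
      rw [timeScale_apply]
      exact (ContinuousMap.dist_lt_iff hε).1 h2 _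
    · have h3 := hsol _ h1
      have h4 : timeScale r (ContinuousMap.superpose F (Γ (x, s₁))) =
        ContinuousMap.superpose F (timeScale r (Γ (x, s₁))) := rfl
      rw [← h4, mul_comm, mul_smul, timePrimitive_timeScale]
      conv_lhs => rw [h3]
      rfl
  let e : UnitTime := ⟨1, by norm_num⟩
  have hev : ∀ x s, dist x m < s₁ → |s| ≤ s₁ →
      Γ (x, s) e = timeExtend (Γ (x, s₁)) (s / s₁) := by
    intro x s hx hs
    have hr : s / s₁ ∈ Set.Icc (-1 : ℝ) 1 := by
      rw [Set.mem_Icc, ← abs_le, abs_div, abs_of_pos hs₁]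
      exact (div_le_one hs₁).2 hs
    have := hscale x hx ⟨s / s₁, hr⟩
    simp only [div_mul_cancel₀ s hs₁.ne'] at this
    rw [this, timeScale_apply]
    simp [e]
  refine ⟨fun p => Γ p e, ?_, ?_, ?_⟩
  · filter_upwards [htar] with p hp
    exact (ContinuousMap.evalCLM ℝ e).contDiff.contDiffAt.comp p (hΓs p hp)
  · have : Filter.Tendsto (fun x : E => (x, (0 : ℝ))) (𝓝 m) (𝓝 (m, 0)) := by
      apply Continuous.tendsto' <;> [fun_prop; rfl]
    filter_upwards [this htar] with x hx
    have := hsol _ hx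
    rw [this]
    simp [hcc]
  · have hnhds : Metric.ball m s₁ ×ˢ Metric.ball (0 : ℝ) s₁ ∈ 𝓝 (m, (0 : ℝ)) :=
      prod_mem_nhds (Metric.ball_mem_nhds _ hs₁) (Metric.ball_mem_nhds _ hs₁)
    filter_upwards [hnhds] with p hp
    obtain ⟨x, s⟩ := p
    obtain ⟨hx, hs⟩ := hp
    simp only [Metric.mem_ball, dist_zero_right, Real.norm_eq_abs] at hx hs
    set η := Γ (x, s₁) with hη
    have h3 := hsol _ (hδ' (hdist x s₁ hx (abs_of_pos hs₁).le)).1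
    have hint : ∀ τ ∈ Set.Icc (-1 : ℝ) 1,
        timeExtend η τ = x + s₁ • ∫ u in (0 : ℝ)..τ, f (timeExtend η u) := by
      intro τ hτ
      have h4 := congrArg (fun γ : C(UnitTime, E) => γ ⟨τ, hτ⟩) h3
      rw [← timeExtend_coe] at h4
      exact h4
    have hd : ∀ τ ∈ Set.Ioo (-1 : ℝ) 1,
        HasDerivAt (timeExtend η) (s₁ • f (timeExtend η τ)) τ := by
      intro τ hτ
      have hc : Continuous fun u => f (timeExtend η u) :=
        hf.continuous.comp (continuous_timeExtend η)
      have h5 := ((hc.integral_hasStrictDerivAt 0 τ).hasDerivAt.const_smul s₁).const_add x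
      refine h5.congr_of_eventuallyEq ?_
      filter_upwards [Ioo_mem_nhds hτ.1 hτ.2] with u hu
      exact hint u (Set.Ioo_subset_Icc_self hu)
    have hr : s / s₁ ∈ Set.Ioo (-1 : ℝ) 1 := by
      rw [Set.mem_Ioo, ← abs_lt, abs_div, abs_of_pos hs₁]
      exact (div_lt_one hs₁).2 hs
    have h6 := (hd _ hr).scomp s ((hasDerivAt_id s).div_const s₁)
    rw [hev x s hx hs.le]
    have h7 : (1 / s₁) • s₁ • f (timeExtend η (s / s₁)) = f (timeExtend η (s / s₁)) := by
      rw [smul_smul, one_div, inv_mul_cancel₀ hs₁.ne', one_smul]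
    rw [← h7]
    refine h6.congr_of_eventuallyEq ?_
    have : ∀ᶠ u in 𝓝 s, |u| < s₁ := continuous_abs.continuousAt.eventually_lt_const hs
    filter_upwards [this] with u hu
    exact hev x u hx hu.le

end Flow

/-! ### Straightening of a vector field. -/

section FlowBox

variable {E : Type*} [NormedAddCommGroup E] [NormedSpace ℝ E] [FiniteDimensional ℝ E]

/-- Multiplication by a bump function; it makes `exists_smooth_flow`, which asks for a globally
smooth field, available for germs. -/
theorem exists_contDiff_eventuallyEq {F : Type*} [NormedAddCommGroup F] [NormedSpace ℝ F]
    {X : E → F} {m : E} (hX : ∀ᶠ x in 𝓝 m, ContDiffAt ℝ ∞ X x) :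
    ∃ f : E → F, ContDiff ℝ ∞ f ∧ f =ᶠ[𝓝 m] X := by
  obtain ⟨ε, hε, h⟩ := Metric.eventually_nhds_iff.1 hX
  let ρ : ContDiffBump m := ⟨ε / 4, ε / 2, by positivity, by linarith⟩
  refine ⟨fun x => ρ x • X x, contDiff_iff_contDiffAt.2 fun x => ?_, ?_⟩
  · by_cases hx : dist x m < ε
    · exact ρ.contDiff.contDiffAt.smul (h hx)
    · have h1 : x ∉ tsupport ρ := by
        rw [ρ.tsupport_eq, Metric.mem_closedBall]
        intro h2
        have : dist x m ≤ ε / 2 := h2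
        linarith
      have h2 : (fun x => ρ x • X x) =ᶠ[𝓝 x] fun _ => 0 := by
        filter_upwards [notMem_tsupport_iff_eventuallyEq.1 h1] with y hy
        rw [hy]; simp
      exact contDiffAt_const.congr_of_eventuallyEq h2
  · filter_upwards [ρ.eventuallyEq_one] with x hx
    rw [hx]; simp

/-- Straightening of a vector field near a point where it does not vanish. -/
theorem exists_flowBox {X : E → E} {m : E} (hX : ∀ᶠ x in 𝓝 m, ContDiffAt ℝ ∞ X x)
    (ℓ : E →L[ℝ] ℝ) (hℓ : ℓ (X m) = 1) :
    ∃ Ψ : E → E, (∀ᶠ y in 𝓝 0, ContDiffAt ℝ ∞ Ψ y) ∧ Ψ 0 = m ∧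
      HasFDerivAt Ψ (ContinuousLinearMap.id ℝ E) 0 ∧
      ∀ᶠ y in 𝓝 0, fderiv ℝ Ψ y (X m) = X (Ψ y) := by
  have : CompleteSpace E := FiniteDimensional.complete ℝ E
  obtain ⟨f, hf, hfX⟩ := exists_contDiff_eventuallyEq hX
  obtain ⟨φ, hφs, hφ0, hφd⟩ := exists_smooth_flow f hf m
  set v := X m with hv
  -- Splits `y` into a component in the hyperplane ker ℓ, used as starting point, and the flow time
  -- ℓ(y). Since `L v = (0, 1)`, moving along `v` advances only the time.
  let L : E →L[ℝ] E × ℝ := (ContinuousLinearMap.id ℝ E - ℓ.smulRight v).prod ℓ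
  let A : E → E × ℝ := fun y => (m, 0) + L y
  have hA0 : A 0 = (m, 0) := by simp [A]
  have hAs : ContDiff ℝ ∞ A := contDiff_const.add L.contDiff
  have hAt : Filter.Tendsto A (𝓝 0) (𝓝 (m, 0)) := hAs.continuous.tendsto' _ _ hA0
  have hAd : ∀ y, HasFDerivAt A L y := fun y => L.hasFDerivAt.const_add _
  have hLv : L v = (0, 1) := by simp [L, hℓ]
  have hφm : φ (m, 0) = m := hφ0.self_of_nhds
  have hΨs : ∀ᶠ y in 𝓝 (0 : E), ContDiffAt ℝ ∞ (φ ∘ A) y := by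
    filter_upwards [hAt hφs] with y hy
    exact ContDiffAt.comp y hy hAs.contDiffAt
  have hφt : ∀ p : E × ℝ, ContDiffAt ℝ ∞ φ p → HasDerivAt (fun s => φ (p.1, s)) (f (φ p)) p.2 →
      fderiv ℝ φ p (0, 1) = f (φ p) := by
    intro p hp hd
    have h1 := (hp.differentiableAt (by simp)).hasFDerivAt
    have h2 : HasDerivAt (fun s : ℝ => (p.1, s)) (0, 1) p.2 :=
      (hasDerivAt_const _ _).prodMk (hasDerivAt_id _)
    exact (HasFDerivAt.comp_hasDerivAt p.2 h1 h2).unique hd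
  have hfd : ∀ y, ContDiffAt ℝ ∞ φ (A y) → fderiv ℝ (φ ∘ A) y = (fderiv ℝ φ (A y)).comp L := by
    intro y hy
    exact ((hy.differentiableAt (by simp)).hasFDerivAt.comp y (hAd y)).fderiv
  refine ⟨φ ∘ A, hΨs, by simp [hA0, hφm], ?_, ?_⟩
  · have h0 := hφs.self_of_nhds
    have h1 := (h0.differentiableAt (by simp)).hasFDerivAt
    have h2 := h1
    rw [← hA0] at h2
    refine (h2.comp (0 : E) (hAd 0)).congr_fderiv ?_
    rw [hA0]
    have h3 : (fderiv ℝ φ (m, 0)).comp (ContinuousLinearMap.inl ℝ E ℝ) =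
        ContinuousLinearMap.id ℝ E := by
      have h4 : HasFDerivAt (fun x : E => ((x, (0 : ℝ)) : E × ℝ))
          (ContinuousLinearMap.inl ℝ E ℝ) m := (hasFDerivAt_id m).prodMk (hasFDerivAt_const _ _)
      have h5 := HasFDerivAt.comp m h1 h4
      exact h5.unique ((hasFDerivAt_id m).congr_of_eventuallyEq hφ0)
    have h6 := hφt _ h0 hφd.self_of_nhds
    rw [hφm, hfX.self_of_nhds, ← hv] at h6
    ext w
    have h7 : L w = ContinuousLinearMap.inl ℝ E ℝ (w - ℓ w • v) + ℓ w • ((0 : E), (1 : ℝ)) := by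
      simp [L]
    have h8 := congrArg (fun B : E →L[ℝ] E => B (w - ℓ w • v)) h3
    simp only [ContinuousLinearMap.comp_apply, ContinuousLinearMap.id_apply] at h8
    rw [ContinuousLinearMap.comp_apply, h7, map_add, map_smul, h6, h8]
    simp
  · have hΨt : Filter.Tendsto (φ ∘ A) (𝓝 0) (𝓝 m) := by
      have := hΨs.self_of_nhds.continuousAt.tendsto
      simpa [hA0, hφm] using this
    filter_upwards [hAt hφs, hAt hφd, hΨt hfX] with y h1 h2 h3
    rw [hfd y h1, ContinuousLinearMap.comp_apply, hLv, hφt _ h1 h2]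
    exact h3

end FlowBox

/-! ### First integrals from a Cauchy characteristic. -/

section FirstIntegrals

variable {E : Type*} [NormedAddCommGroup E] [NormedSpace ℝ E]

/-- In a flow box of `X`, a form annihilated by `X` is differentiated along `X` by contracting its
exterior derivative with `X`. -/
theorem fderiv_pullback_flowBox {X : E → E} {α : E → E →L[ℝ] ℝ} {Ψ : E → E} {v y : E}
    (hX : ContDiffAt ℝ ∞ X (Ψ y)) (hα : ContDiffAt ℝ ∞ α (Ψ y)) (hΨ : ContDiffAt ℝ ∞ Ψ y)
    (hv : ∀ᶠ z in 𝓝 y, fderiv ℝ Ψ z v = X (Ψ z)) (h0 : ∀ᶠ z in 𝓝 (Ψ y), α z (X z) = 0) (w : E) :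
    fderiv ℝ (fun z => (α (Ψ z)).comp (fderiv ℝ Ψ z)) y v w =
      fderiv ℝ α (Ψ y) (X (Ψ y)) (fderiv ℝ Ψ y w) -
        fderiv ℝ α (Ψ y) (fderiv ℝ Ψ y w) (X (Ψ y)) := by
  have dΨ := (hΨ.differentiableAt (by simp)).hasFDerivAt
  have dα := (hα.differentiableAt (by simp)).hasFDerivAt
  have dX := (hX.differentiableAt (by simp)).hasFDerivAt
  have hΨ' : ContDiffAt ℝ ∞ (fderiv ℝ Ψ) y := hΨ.fderiv_right (by simp)
  have ddΨ := (hΨ'.differentiableAt (by simp)).hasFDerivAt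
  have h1 := ((dα.comp y dΨ).clm_comp ddΨ).fderiv
  have h1' : fderiv ℝ (fun z => (α (Ψ z)).comp (fderiv ℝ Ψ z)) y v w =
      fderiv ℝ α (Ψ y) (fderiv ℝ Ψ y v) (fderiv ℝ Ψ y w)
        + α (Ψ y) (fderiv ℝ (fderiv ℝ Ψ) y v w) := by
    rw [show (fun z => (α (Ψ z)).comp (fderiv ℝ Ψ z)) =
      fun z => ((α ∘ Ψ) z).comp (fderiv ℝ Ψ z) from rfl, h1]
    simp [add_comm]
  -- Symmetry of D²Ψ and differentiation of DΨ·v = X ∘ Ψ turn the second order term into α(DX·DΨ w).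
  -- The derivative of α(X) = 0, in `h5`, trades that for a derivative of α.
  have hsymm : fderiv ℝ (fderiv ℝ Ψ) y v w = fderiv ℝ (fderiv ℝ Ψ) y w v :=
    (hΨ.isSymmSndFDerivAt (by simpa using ENat.LEInfty.out)) v w
  have h2 : fderiv ℝ (fderiv ℝ Ψ) y w v = fderiv ℝ X (Ψ y) (fderiv ℝ Ψ y w) := by
    have h3 := (ddΨ.clm_apply (hasFDerivAt_const v y)).congr_of_eventuallyEq
      (hv.mono fun z hz => hz.symm)
    have h4 := congrArg (fun B : E →L[ℝ] E => B w) (h3.unique (dX.comp y dΨ))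
    simpa using h4
  have h5 : fderiv ℝ α (Ψ y) (fderiv ℝ Ψ y w) (X (Ψ y))
      + α (Ψ y) (fderiv ℝ X (Ψ y) (fderiv ℝ Ψ y w)) = 0 := by
    have h6 := (dα.clm_apply dX).unique ((hasFDerivAt_const (0 : ℝ) _).congr_of_eventuallyEq h0)
    have h7 := congrArg (fun B : E →L[ℝ] ℝ => B (fderiv ℝ Ψ y w)) h6
    simpa [add_comm] using h7
  rw [h1', hsymm, h2, hv.self_of_nhds]
  linarith

/-- The quotient of two values of a form is constant along a direction in which the derivative of
the form is proportional to the form. -/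
theorem form_ratio_const_along {α : E → E →L[ℝ] ℝ} {v c : E} {r : ℝ}
    (hα : ∀ y ∈ Metric.ball (0 : E) r, DifferentiableAt ℝ α y)
    (hc : ∀ y ∈ Metric.ball (0 : E) r, α y c ≠ 0)
    (hv : ∀ y ∈ Metric.ball (0 : E) r, ∀ w, α y w = 0 → fderiv ℝ α y v w = 0)
    {y : E} {s : ℝ} (hy : y ∈ Metric.ball (0 : E) r) (hys : y + s • v ∈ Metric.ball (0 : E) r)
    (w : E) : α (y + s • v) w / α (y + s • v) c = α y w / α y c := by
  let p : ℝ → E := fun t => y + t • s • v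
  have hp : ∀ t ∈ Set.Icc (0 : ℝ) 1, p t ∈ Metric.ball (0 : E) r := by
    intro t ht
    exact (convex_ball (0 : E) r).add_smul_mem hy hys ht
  have hpd : ∀ t, HasDerivAt p (s • v) t := by
    intro t
    have := ((hasDerivAt_id t).smul_const (s • v)).const_add y
    rwa [one_smul] at this
  have hαd : ∀ t ∈ Set.Icc (0 : ℝ) 1, ∀ u : E,
      HasDerivAt (fun t => α (p t) u) (s * fderiv ℝ α (p t) v u) t := by
    intro t ht u
    have h1 := (hα _ (hp t ht)).hasFDerivAt.comp_hasDerivAt t (hpd t)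
    simpa using h1.clm_apply (hasDerivAt_const t u)
  have hd : ∀ t ∈ Set.Icc (0 : ℝ) 1,
      HasDerivAt (fun t => α (p t) w / α (p t) c) 0 t := by
    intro t ht
    have hc' := hc _ (hp t ht)
    have h1 := (hαd t ht w).div (hαd t ht c) hc'
    -- This combination of `w` and `c` lies in the kernel of the form; its image under the
    -- derivative is, up to the factor `s`, the numerator of the quotient rule.
    have h2 := hv _ (hp t ht) (α (p t) c • w - α (p t) w • c) (by simp [mul_comm])
    simp only [map_sub, map_smul, smul_eq_mul] at h2
    convert! h1 using 1
    rw [eq_comm, div_eq_zero_iff]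
    left
    linear_combination s * h2
  have h := constant_of_has_deriv_right_zero (f := fun t => α (p t) w / α (p t) c) (a := 0) (b := 1)
    (fun t ht => (hd t ht).continuousAt.continuousWithinAt)
    (fun t ht => (hd t (Set.Ico_subset_Icc_self ht)).hasDerivWithinAt) 1 (by simp)
  simpa [p] using h

/-- A plane field `ker α` with Cauchy characteristic `X` contains a rank two integrable distribution
through `X` with prescribed value at the base point, given by two first integrals. -/
theorem exists_first_integrals [FiniteDimensional ℝ E] {X : E → E} {α : E → E →L[ℝ] ℝ} {m b c : E}
    (hX : ∀ᶠ y in 𝓝 m, ContDiffAt ℝ ∞ X y) (hα : ∀ᶠ y in 𝓝 m, ContDiffAt ℝ ∞ α y)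
    (h0 : ∀ᶠ y in 𝓝 m, α y (X y) = 0)
    (hd : ∀ᶠ y in 𝓝 m, ∀ w, α y w = 0 → fderiv ℝ α y (X y) w = fderiv ℝ α y w (X y))
    (l l₁ l₂ μ : E →L[ℝ] ℝ) (hlX : l (X m) = 1) (hlb : l b = 0) (hlc : l c = 0)
    (hαb : α m b = 0) (hαc : α m c ≠ 0) (hμ : μ b = 1)
    (h1X : l₁ (X m) = 0) (h2X : l₂ (X m) = 0)
    (hspan : ∀ w, l₁ w = 0 → l₂ w = 0 → ∃ s t : ℝ, w = s • X m + t • b) :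
    ∃ x y : E → ℝ, (∀ᶠ z in 𝓝 m, ContDiffAt ℝ ∞ x z) ∧ (∀ᶠ z in 𝓝 m, ContDiffAt ℝ ∞ y z) ∧
      (∀ᶠ z in 𝓝 m, fderiv ℝ x z (X z) = 0) ∧ (∀ᶠ z in 𝓝 m, fderiv ℝ y z (X z) = 0) ∧
      fderiv ℝ x m = l₁ ∧ fderiv ℝ y m = l₂ ∧
      ∀ᶠ z in 𝓝 m, ∀ w, fderiv ℝ x z w = 0 → fderiv ℝ y z w = 0 → α z w = 0 := by
  have : CompleteSpace E := FiniteDimensional.complete ℝ E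
  obtain ⟨Ψ, hΨs, hΨ0, hΨd, hΨX⟩ := exists_flowBox hX l hlX
  set v := X m with hv
  have hΨt : Filter.Tendsto Ψ (𝓝 0) (𝓝 m) := by
    have := hΨd.continuousAt.tendsto
    rwa [hΨ0] at this
  -- the pulled back form
  let α' : E → E →L[ℝ] ℝ := fun z => (α (Ψ z)).comp (fderiv ℝ Ψ z)
  have hα's : ∀ᶠ z in 𝓝 0, ContDiffAt ℝ ∞ α' z := by
    filter_upwards [hΨs, hΨt.eventually hα] with z h1 h2
    exact (ContDiffAt.comp z h2 h1).clm_comp (h1.fderiv_right (by simp))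
  have hα'0 : ∀ w, α' 0 w = α m w := by
    intro w; simp [α', hΨ0, hΨd.fderiv]
  have hα'd : ∀ᶠ z in 𝓝 0, ∀ w, α' z w = 0 → fderiv ℝ α' z v w = 0 := by
    filter_upwards [hΨs, hΨt.eventually hα, hΨt.eventually hX, hΨX.eventually_nhds,
      hΨt.eventually h0.eventually_nhds, hΨt.eventually hd] with z h1 h2 h3 h4 h5 h6 w hw
    have h7 := fderiv_pullback_flowBox h3 h2 h1 h4 h5 w
    rw [h7, sub_eq_zero]
    exact h6 _ hw
  have hα'c : ∀ᶠ z in 𝓝 0, α' z c ≠ 0 := by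
    have h1 : ContinuousAt (fun z => α' z c) 0 :=
      hα's.self_of_nhds.continuousAt.clm_apply continuousAt_const
    exact h1.eventually_ne (by rw [hα'0]; exact hαc)
  obtain ⟨r, hr, hr'⟩ := Metric.eventually_nhds_iff_ball.1 (hα's.and (hα'c.and hα'd))
  have hratio := fun (z : E) (s : ℝ) => form_ratio_const_along (y := z) (s := s) (v := v)
    (fun y hy => (hr' y hy).1.differentiableAt (by simp)) (fun y hy => (hr' y hy).2.1)
    (fun y hy => (hr' y hy).2.2)
  -- the field on the quotient
  let H : Submodule ℝ E := LinearMap.ker l.toLinearMap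
  let b' : H := ⟨b, hlb⟩
  let c' : H := ⟨c, hlc⟩
  -- `H` is the slice transverse to X in the flow box, a model of the quotient by the flow. `V` is
  -- the correction of `b` by a multiple of `c` that lies in the kernel of the form.
  let V : H → H := fun z => b' - (α' z b / α' z c) • c'
  have hVt : Filter.Tendsto (fun z : H => (z : E)) (𝓝 0) (𝓝 0) :=
    continuous_subtype_val.tendsto' _ _ rfl
  have hVs : ∀ᶠ z in 𝓝 (0 : H), ContDiffAt ℝ ∞ V z := by
    filter_upwards [hVt.eventually hα's, hVt.eventually hα'c] with z h1 h2
    have h3 : ContDiffAt ℝ ∞ (fun z : H => α' z) z :=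
      ContDiffAt.comp z h1 H.subtypeL.contDiff.contDiffAt
    exact contDiffAt_const.sub (((h3.clm_apply contDiffAt_const).div
      (h3.clm_apply contDiffAt_const) h2).smul contDiffAt_const)
  have hV0 : V 0 = b' := by
    have : α' (0 : H) b = 0 := by
      rw [Submodule.coe_zero, hα'0, hαb]
    simp only [V, this, zero_div, zero_smul, sub_zero]
  obtain ⟨Θ, hΘs, hΘ0, hΘd, hΘV⟩ := exists_flowBox hVs (μ.comp H.subtypeL) (by rw [hV0]; exact hμ)
  rw [hV0] at hΘV
  let P : E →L[ℝ] H := (ContinuousLinearMap.id ℝ E - l.smulRight v).codRestrict H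
    (fun u => by simp [H, hlX])
  have hP : ∀ u, (P u : E) = u - l u • v := fun u => rfl
  have hPv : P v = 0 := Subtype.ext (by simp [hP, hlX])
  have hPb : P b = b' := Subtype.ext (by simp [hP, hlb, b'])
  have hPt : Filter.Tendsto P (𝓝 0) (𝓝 0) := P.continuous.tendsto' _ _ (map_zero P)
  -- Straightens `V` on the slice by Θ and leaves the flow direction `v` alone. After composition
  -- with Ψ, the constant field `v` becomes X and `b` becomes a field in ker α.
  let q : E → E := fun u => (Θ (P u) : E) + l u • v
  have hq0 : q 0 = 0 := by simp [q, hΘ0]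
  have hqs : ∀ᶠ u in 𝓝 0, ContDiffAt ℝ ∞ q u := by
    filter_upwards [hPt.eventually hΘs] with u hu
    exact (H.subtypeL.contDiff.contDiffAt.comp u
      (ContDiffAt.comp u hu P.contDiff.contDiffAt)).add
        (l.contDiff.contDiffAt.smul contDiffAt_const)
  have hqt : Filter.Tendsto q (𝓝 0) (𝓝 0) := by
    have := hqs.self_of_nhds.continuousAt.tendsto
    rwa [hq0] at this
  have hqd : ∀ u, ∀ D : H →L[ℝ] H, HasFDerivAt Θ D (P u) → HasFDerivAt q
      ((H.subtypeL.comp (D.comp P)) + l.smulRight v) u := by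
    intro u D hD
    exact (H.subtypeL.hasFDerivAt.comp u (hD.comp u P.hasFDerivAt)).add
      (l.hasFDerivAt.smul_const v)
  let Ξ : E → E := fun u => Ψ (q u)
  have hΞs : ∀ᶠ u in 𝓝 0, ContDiffAt ℝ ∞ Ξ u := by
    filter_upwards [hqs, hqt.eventually hΨs] with u h1 h2
    exact ContDiffAt.comp u h2 h1
  have hΞ0 : Ξ 0 = m := by simp [Ξ, hq0, hΨ0]
  have hΞd0 : HasFDerivAt Ξ ((ContinuousLinearEquiv.refl ℝ E : E ≃L[ℝ] E) : E →L[ℝ] E) 0 := by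
    have h1 : HasFDerivAt Θ (ContinuousLinearMap.id ℝ H) (P 0) := by rwa [map_zero]
    have h2 := hqd 0 _ h1
    have h3 := hΨd
    rw [← hq0] at h3
    refine (h3.comp (0 : E) h2).congr_fderiv ?_
    ext w
    simp [hP]
  obtain ⟨g, hg0, hgΞ, hgs, hgd, hgi⟩ := exists_smooth_localInverse hΞs hΞd0
  have hmt : m ∈ g.target := by
    rw [← hΞ0, ← hgΞ]; exact g.map_source hg0
  have hgm : g.symm m = 0 := by
    rw [← hΞ0, ← hgΞ]; exact g.left_inv hg0
  have hgt : Filter.Tendsto g.symm (𝓝 m) (𝓝 0) := by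
    have := (g.continuousAt_symm hmt).tendsto
    rwa [hgm] at this
  have hmn : ∀ᶠ z in 𝓝 m, z ∈ g.target := g.open_target.mem_nhds hmt
  -- the derivative of the coordinates
  have key : ∀ᶠ u in 𝓝 0, fderiv ℝ Ξ u v = X (Ξ u) ∧ α (Ξ u) (fderiv ℝ Ξ u b) = 0 := by
    have hball := Metric.ball_mem_nhds (0 : E) hr
    have hΘt : Filter.Tendsto (fun u => (Θ (P u) : E)) (𝓝 0) (𝓝 0) := by
      have h1 : Filter.Tendsto Θ (𝓝 0) (𝓝 0) := by
        have := hΘd.continuousAt.tendsto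
        rwa [hΘ0] at this
      exact hVt.comp (h1.comp hPt)
    filter_upwards [hqt.eventually hΨs, hqt.eventually hΨX, hPt.eventually hΘs,
      hPt.eventually hΘV, hqt hball, hΘt hball] with u h1 h2 h3 h4 h5 h6
    have hD := hqd u _ (h3.differentiableAt (by simp)).hasFDerivAt
    have hDΞ := ((h1.differentiableAt (by simp)).hasFDerivAt.comp u hD).fderiv
    have hDΞ' : fderiv ℝ Ξ u = _ := hDΞ
    rw [hDΞ']
    constructor
    · simp only [ContinuousLinearMap.comp_apply, add_apply, hPv, map_zero,
        ContinuousLinearMap.smulRight_apply, hlX, one_smul, zero_add]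
      exact h2
    · simp only [ContinuousLinearMap.comp_apply, add_apply, hPb,
        ContinuousLinearMap.smulRight_apply, hlb, zero_smul, add_zero]
      have h4' : fderiv ℝ Θ (P u) b' = V (Θ (P u)) := h4
      rw [h4']
      change α' (q u) (V (Θ (P u)) : E) = 0
      -- The ratio defining `V` is constant along `v`, so the value computed on the slice still
      -- annihilates the form at `q u`.
      have h7 := hratio (Θ (P u)) (l u) h6 h5 b
      have h8 := (hr' _ h5).2.1
      have h9 : (V (Θ (P u)) : E) = b - (α' (q u) b / α' (q u) c) • c := by
        rw [show α' (q u) b / α' (q u) c = _ from h7]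
        rfl
      rw [h9, map_sub, map_smul, smul_eq_mul, div_mul_cancel₀ _ h8, sub_self]
  have hder : ∀ z ∈ g.target, ∃ A : E ≃L[ℝ] E, HasFDerivAt Ξ (A : E →L[ℝ] E) (g.symm z) ∧
      ∀ k : E →L[ℝ] ℝ, fderiv ℝ (fun z => k (g.symm z)) z = k.comp (A.symm : E →L[ℝ] E) := by
    intro z hz
    obtain ⟨A, hA⟩ := hgd _ (g.map_target hz)
    have hA' : HasFDerivAt g (A : E →L[ℝ] E) (g.symm z) :=
      hA.congr_of_eventuallyEq (Filter.Eventually.of_forall hgΞ)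
    exact ⟨A, hA, fun k => (k.hasFDerivAt.comp z (g.hasFDerivAt_symm hz hA')).fderiv⟩
  have hsm : ∀ k : E →L[ℝ] ℝ, ∀ᶠ z in 𝓝 m, ContDiffAt ℝ ∞ (fun z => k (g.symm z)) z := by
    intro k
    filter_upwards [hmn] with z hz
    exact k.contDiff.contDiffAt.comp z (hgi z hz)
  have hX0 : ∀ k : E →L[ℝ] ℝ, k v = 0 →
      ∀ᶠ z in 𝓝 m, fderiv ℝ (fun z => k (g.symm z)) z (X z) = 0 := by
    intro k hk
    filter_upwards [hmn, hgt.eventually key] with z hz h1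
    obtain ⟨A, hA, hA'⟩ := hder z hz
    have h2 := h1.1
    rw [hA.fderiv, ← hgΞ, g.right_inv hz] at h2
    rw [hA' k, ← h2]
    simp [hk]
  have hm' : ∀ k : E →L[ℝ] ℝ, fderiv ℝ (fun z => k (g.symm z)) m = k := by
    intro k
    obtain ⟨A, hA, hA'⟩ := hder m hmt
    rw [hgm] at hA
    have h1 := hA.unique hΞd0
    rw [hA' k]
    ext w
    have h2 : A w = w := congrArg (fun B : E →L[ℝ] E => B w) h1
    have h3 : A.symm w = w := by rw [ContinuousLinearEquiv.symm_apply_eq, h2]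
    simp [h3]
  refine ⟨fun z => l₁ (g.symm z), fun z => l₂ (g.symm z), hsm _, hsm _, hX0 _ h1X, hX0 _ h2X,
    hm' _, hm' _, ?_⟩
  filter_upwards [hmn, hgt.eventually key, h0] with z hz h1 h2 w hw1 hw2
  obtain ⟨A, hA, hA'⟩ := hder z hz
  obtain ⟨h3, h4⟩ := h1
  rw [hA.fderiv, ← hgΞ, g.right_inv hz] at h3 h4
  rw [hA'] at hw1 hw2
  -- The common kernel of `l₁` and `l₂` is spanned by `v` and `b`, whose images under `A` both lie
  -- in ker α.
  obtain ⟨s, t, hst⟩ := hspan (A.symm w) hw1 hw2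
  have h5 : w = s • A v + t • A b := by
    rw [← map_smul, ← map_smul, ← map_add, ← hst, ContinuousLinearEquiv.apply_symm_apply]
  have h3' : A v = X z := h3
  have h4' : α z (A b) = 0 := h4
  rw [h5, map_add, map_smul, map_smul, h3', h2, h4']
  simp

end FirstIntegrals

/-! ### Contact forms, Engel charts and coframes. -/

section EngelCoordinates

variable {E : Type*} [NormedAddCommGroup E] [NormedSpace ℝ E]

/-- Cartan's formula for two fields on which the form is constant. -/
theorem form_lieBracket {α : E → E →L[ℝ] ℝ} {V W : E → E} {y : E} {s t : ℝ}
    (hα : DifferentiableAt ℝ α y) (hV : DifferentiableAt ℝ V y) (hW : DifferentiableAt ℝ W y)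
    (hαV : ∀ᶠ z in 𝓝 y, α z (V z) = s) (hαW : ∀ᶠ z in 𝓝 y, α z (W z) = t) :
    α y (VectorField.lieBracket ℝ V W y) =
      fderiv ℝ α y (W y) (V y) - fderiv ℝ α y (V y) (W y) := by
  have key : ∀ (U : E → E) (r : ℝ), DifferentiableAt ℝ U y → (∀ᶠ z in 𝓝 y, α z (U z) = r) →
      ∀ v, fderiv ℝ α y v (U y) + α y (fderiv ℝ U y v) = 0 := by
    intro U r hU hαU v
    have h1 := (hα.hasFDerivAt.clm_apply hU.hasFDerivAt).unique
      ((hasFDerivAt_const r y).congr_of_eventuallyEq hαU)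
    have h2 := congrArg (fun B : E →L[ℝ] ℝ => B v) h1
    simpa [add_comm] using h2
  have h1 := key V s hV hαV (W y)
  have h2 := key W t hW hαW (V y)
  rw [VectorField.lieBracket, map_sub]
  linarith

/-- The form `dy - p dx` on the bracket of two of its zeros. -/
theorem contact_lieBracket {x y p : E → ℝ} {V W : E → E} {z : E}
    (hx : ContDiffAt ℝ ∞ x z) (hy : ContDiffAt ℝ ∞ y z) (hp : ContDiffAt ℝ ∞ p z)
    (hV : DifferentiableAt ℝ V z) (hW : DifferentiableAt ℝ W z)
    (hyV : ∀ᶠ u in 𝓝 z, fderiv ℝ y u (V u) = p u * fderiv ℝ x u (V u))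
    (hyW : ∀ᶠ u in 𝓝 z, fderiv ℝ y u (W u) = p u * fderiv ℝ x u (W u)) :
    fderiv ℝ y z (VectorField.lieBracket ℝ V W z)
        - p z * fderiv ℝ x z (VectorField.lieBracket ℝ V W z) =
      fderiv ℝ p z (V z) * fderiv ℝ x z (W z) - fderiv ℝ p z (W z) * fderiv ℝ x z (V z) := by
  have d1 : ∀ {f : E → ℝ}, ContDiffAt ℝ ∞ f z → DifferentiableAt ℝ (fderiv ℝ f) z := fun hf =>
    (hf.fderiv_right (m := ∞) (by simp)).differentiableAt (by simp)
  have hs : ∀ {f : E → ℝ}, ContDiffAt ℝ ∞ f z → ∀ v w,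
      fderiv ℝ (fderiv ℝ f) z v w = fderiv ℝ (fderiv ℝ f) z w v := fun hf =>
    hf.isSymmSndFDerivAt (by simpa using ENat.LEInfty.out)
  have hω : HasFDerivAt (fun u => fderiv ℝ y u - p u • fderiv ℝ x u) _ z :=
    (d1 hy).hasFDerivAt.sub
      ((hp.differentiableAt (by simp)).hasFDerivAt.smul (d1 hx).hasFDerivAt)
  have h := form_lieBracket (α := fun u => fderiv ℝ y u - p u • fderiv ℝ x u) (s := 0) (t := 0)
    hω.differentiableAt hV hW
    (by filter_upwards [hyV] with u hu; simp [hu])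
    (by filter_upwards [hyW] with u hu; simp [hu])
  rw [hω.fderiv] at h
  simp only [sub_apply, smul_apply, add_apply, ContinuousLinearMap.smulRight_apply,
    smul_eq_mul] at h
  -- The second derivatives of x and y cancel by symmetry; only dp ∧ dx is left.
  rw [h, hs hx (W z) (V z), hs hy (W z) (V z)]
  ring

/-- Coordinates in which the flag of the frame `e₁`, `e₂`, `e₃` is the canonical one. -/
structure IsEngelChart (e₁ e₂ e₃ : E → E) (m : E) (x y p q : E → ℝ) : Prop where
  smooth_x : ∀ᶠ z in 𝓝 m, ContDiffAt ℝ ∞ x z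
  smooth_y : ∀ᶠ z in 𝓝 m, ContDiffAt ℝ ∞ y z
  smooth_p : ∀ᶠ z in 𝓝 m, ContDiffAt ℝ ∞ p z
  smooth_q : ∀ᶠ z in 𝓝 m, ContDiffAt ℝ ∞ q z
  x₁ : ∀ᶠ z in 𝓝 m, fderiv ℝ x z (e₁ z) = 0
  y₁ : ∀ᶠ z in 𝓝 m, fderiv ℝ y z (e₁ z) = 0
  p₁ : ∀ᶠ z in 𝓝 m, fderiv ℝ p z (e₁ z) = 0
  y₂ : ∀ᶠ z in 𝓝 m, fderiv ℝ y z (e₂ z) = p z * fderiv ℝ x z (e₂ z)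
  p₂ : ∀ᶠ z in 𝓝 m, fderiv ℝ p z (e₂ z) = q z * fderiv ℝ x z (e₂ z)
  y₃ : ∀ᶠ z in 𝓝 m, fderiv ℝ y z (e₃ z) = p z * fderiv ℝ x z (e₃ z)
  inj : ∀ w, fderiv ℝ x m w = 0 → fderiv ℝ y m w = 0 → fderiv ℝ p m w = 0 →
    fderiv ℝ q m w = 0 → w = 0

/-- Engel charts may be moved so as to take prescribed values. -/
theorem IsEngelChart.exists_shift {e₁ e₂ e₃ : E → E} {m : E} {x y p q : E → ℝ}
    (h : IsEngelChart e₁ e₂ e₃ m x y p q) (x₀ y₀ p₀ q₀ : ℝ) :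
    ∃ x' y' p' q' : E → ℝ, IsEngelChart e₁ e₂ e₃ m x' y' p' q' ∧
      x' m = x₀ ∧ y' m = y₀ ∧ p' m = p₀ ∧ q' m = q₀ := by
  -- The move is the prolongation of x ↦ x + a, y ↦ y + b + k x + (l/2) x², with x on the right the
  -- old coordinate: p gains k + l x and q gains l. The constants are solved for in the order q, p,
  -- y.
  obtain ⟨a, ha⟩ : ∃ a, a = x₀ - x m := ⟨_, rfl⟩
  obtain ⟨l, hl⟩ : ∃ l, l = q₀ - q m := ⟨_, rfl⟩
  obtain ⟨k, hk⟩ : ∃ k, k = p₀ - p m - l * x m := ⟨_, rfl⟩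
  obtain ⟨b, hb⟩ : ∃ b, b = y₀ - y m - k * x m - l / 2 * x m ^ 2 := ⟨_, rfl⟩
  have hd : ∀ᶠ z in 𝓝 m, fderiv ℝ (fun z => x z + a) z = fderiv ℝ x z ∧
      fderiv ℝ (fun z => y z + (b + k * x z + l / 2 * x z ^ 2)) z =
        fderiv ℝ y z + (k + l * x z) • fderiv ℝ x z ∧
      fderiv ℝ (fun z => p z + (k + l * x z)) z = fderiv ℝ p z + l • fderiv ℝ x z ∧
      fderiv ℝ (fun z => q z + l) z = fderiv ℝ q z := by
    filter_upwards [h.smooth_x, h.smooth_y, h.smooth_p] with z hx hy hp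
    have dx := (hx.differentiableAt (by simp)).hasFDerivAt
    have dy := (hy.differentiableAt (by simp)).hasFDerivAt
    have dp := (hp.differentiableAt (by simp)).hasFDerivAt
    refine ⟨fderiv_add_const _, ?_, ?_, fderiv_add_const _⟩
    · have h1 := dy.add (((dx.const_mul k).const_add b).add ((dx.pow 2).const_mul (l / 2)))
      refine (h1.congr_fderiv ?_).fderiv
      ext w
      simp
      ring
    · exact (dp.add ((dx.const_mul l).const_add k)).fderiv
  refine ⟨fun z => x z + a, fun z => y z + (b + k * x z + l / 2 * x z ^ 2),
    fun z => p z + (k + l * x z), fun z => q z + l, ?_, ?_, ?_, ?_, ?_⟩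
  · refine ⟨?_, ?_, ?_, ?_, ?_, ?_, ?_, ?_, ?_, ?_, ?_⟩
    · filter_upwards [h.smooth_x] with z hx using hx.add contDiffAt_const
    · filter_upwards [h.smooth_x, h.smooth_y] with z hx hy
      exact hy.add ((contDiffAt_const.add (contDiffAt_const.mul hx)).add
        (contDiffAt_const.mul (hx.pow 2)))
    · filter_upwards [h.smooth_x, h.smooth_p] with z hx hp
      exact hp.add (contDiffAt_const.add (contDiffAt_const.mul hx))
    · filter_upwards [h.smooth_q] with z hq using hq.add contDiffAt_const
    · filter_upwards [hd, h.x₁] with z hz h1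
      rw [hz.1, h1]
    · filter_upwards [hd, h.x₁, h.y₁] with z hz h1 h2
      simp [hz.2.1, h1, h2]
    · filter_upwards [hd, h.x₁, h.p₁] with z hz h1 h2
      simp [hz.2.2.1, h1, h2]
    · filter_upwards [hd, h.y₂] with z hz h1
      simp [hz.1, hz.2.1, h1]; ring
    · filter_upwards [hd, h.p₂] with z hz h1
      simp [hz.1, hz.2.2.1, h1]; ring
    · filter_upwards [hd, h.y₃] with z hz h1
      simp [hz.1, hz.2.1, h1]; ring
    · obtain ⟨h1, h2, h3, h4⟩ := hd.self_of_nhds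
      intro w hw1 hw2 hw3 hw4
      rw [h1] at hw1
      rw [h2] at hw2
      rw [h3] at hw3
      rw [h4] at hw4
      exact h.inj w hw1 (by simpa [hw1] using hw2) (by simpa [hw1] using hw3) hw4
  · simp [ha]
  · rw [hb]; ring
  · simp only [hk]; ring
  · simp [hl]

variable [FiniteDimensional ℝ E]

/-- The coframe dual to three vector fields and a constant one. -/
theorem exists_coframe (b : Module.Basis (Fin 4) ℝ E) {e : Fin 3 → E → E} {m : E}
    (he : ∀ i, ∀ᶠ z in 𝓝 m, ContDiffAt ℝ ∞ (e i) z) (hm : ∀ i, e i m = b i.castSucc) :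
    ∃ θ : Fin 4 → E → E →L[ℝ] ℝ, (∀ k, ∀ᶠ z in 𝓝 m, ContDiffAt ℝ ∞ (θ k) z) ∧
      (∀ᶠ z in 𝓝 m, ∀ k i, θ k z (e i z) = if k = i.castSucc then 1 else 0) ∧
      (∀ᶠ z in 𝓝 m, ∀ k, θ k z (b 3) = if k = 3 then 1 else 0) ∧
      ∀ᶠ z in 𝓝 m, ∀ w, w = ∑ i, θ i.castSucc z w • e i z + θ 3 z w • b 3 := by
  have : CompleteSpace E := FiniteDimensional.complete ℝ E
  let ε : Fin 4 → E →L[ℝ] ℝ := fun i => LinearMap.toContinuousLinearMap (b.coord i)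
  have hε : ∀ i j, ε i (b j) = if i = j then 1 else 0 := by
    intro i j
    simp [ε, Finsupp.single_apply, eq_comm]
  -- `A z` sends the basis `b` to the frame at z completed by `b 3`. It is the identity at m, hence
  -- invertible nearby, and the coframe is the dual basis composed with its inverse.
  let A : E → E →L[ℝ] E := fun z =>
    ∑ i : Fin 3, (ε i.castSucc).smulRight (e i z) + (ε 3).smulRight (b 3)
  have hA : ∀ z w, A z w = ∑ i : Fin 3, ε i.castSucc w • e i z + ε 3 w • b 3 := by
    intro z w
    simp [A]
  have hAm : A m = ContinuousLinearMap.id ℝ E := by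
    ext w
    rw [hA]
    simp only [hm]
    have := b.sum_repr w
    rw [Fin.sum_univ_castSucc] at this
    exact this
  have hAs : ∀ᶠ z in 𝓝 m, ContDiffAt ℝ ∞ A z := by
    filter_upwards [Filter.eventually_all.2 he] with z hz
    refine (ContDiffAt.sum fun i _ => ?_).add contDiffAt_const
    exact (ContinuousLinearMap.smulRightL ℝ E E (ε i.castSucc)).contDiff.contDiffAt.comp z (hz i)
  have hAe : ∀ᶠ z in 𝓝 m, ∃ B : E ≃L[ℝ] E, (B : E →L[ℝ] E) = A z := by
    have h1 := (ContinuousLinearEquiv.refl ℝ E).nhds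
    have h2 : A m = ((ContinuousLinearEquiv.refl ℝ E : E ≃L[ℝ] E) : E →L[ℝ] E) := hAm
    rw [← h2] at h1
    exact hAs.self_of_nhds.continuousAt h1
  have hlast : ∀ i : Fin 3, ((3 : Fin 4) = i.castSucc) = False := by
    intro i; fin_cases i <;> simp [Fin.ext_iff]
  have hlast' : ∀ i : Fin 3, (i.castSucc = (3 : Fin 4)) = False := by
    intro i; fin_cases i <;> simp [Fin.ext_iff]
  have hAb : ∀ z, (∀ i, A z (b (Fin.castSucc i)) = e i z) ∧ A z (b 3) = b 3 := by
    intro z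
    constructor
    · intro i
      rw [hA, Finset.sum_eq_single i]
      · simp [hε, hlast]
      · intro j _ hj
        simp [hε, hj]
      · simp
    · rw [hA]
      simp [hε, hlast']
  refine ⟨fun k z => (ε k).comp (A z).inverse, fun k => ?_, ?_, ?_, ?_⟩
  · filter_upwards [hAs, hAe] with z h1 ⟨B, hB⟩
    refine contDiffAt_const.clm_comp ?_
    have h2 := contDiffAt_map_inverse (n := ∞) B
    rw [hB] at h2
    exact h2.comp z h1
  · filter_upwards [hAe] with z ⟨B, hB⟩ k i
    have h1 : B (b i.castSucc) = e i z := by rw [← (hAb z).1 i, ← hB]; rfl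
    rw [← hB, ContinuousLinearMap.inverse_equiv, ← h1]
    simp [hε]
  · filter_upwards [hAe] with z ⟨B, hB⟩ k
    have h1 : B (b 3) = b 3 := by
      conv_rhs => rw [← (hAb z).2, ← hB]
      rfl
    have h2 : B.symm (b 3) = b 3 := by rw [ContinuousLinearEquiv.symm_apply_eq, h1]
    rw [← hB, ContinuousLinearMap.inverse_equiv]
    simp [hε, h2]
  · filter_upwards [hAe] with z ⟨B, hB⟩ w
    have h1 : A z (B.symm w) = w := by rw [← hB]; simp
    rw [hA] at h1
    rw [← hB, ContinuousLinearMap.inverse_equiv]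
    exact h1.symm

/-- A smooth form whose kernel is spanned by three given vector fields. -/
theorem exists_annihilating_form (b : Module.Basis (Fin 4) ℝ E) {e : Fin 3 → E → E} {m : E}
    (he : ∀ i, ∀ᶠ z in 𝓝 m, ContDiffAt ℝ ∞ (e i) z) (hm : ∀ i, e i m = b i.castSucc) :
    ∃ α : E → E →L[ℝ] ℝ, (∀ᶠ z in 𝓝 m, ContDiffAt ℝ ∞ α z) ∧
      (∀ᶠ z in 𝓝 m, ∀ i, α z (e i z) = 0) ∧ (∀ᶠ z in 𝓝 m, α z (b 3) = 1) ∧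
      ∀ᶠ z in 𝓝 m, ∀ w, α z w = 0 → ∃ c : Fin 3 → ℝ, w = ∑ i, c i • e i z := by
  obtain ⟨θ, hθ, hθe, hθ3, hθw⟩ := exists_coframe b he hm
  refine ⟨θ 3, hθ 3, ?_, ?_, ?_⟩
  · filter_upwards [hθe] with z hz i
    rw [hz]
    fin_cases i <;> simp [Fin.ext_iff]
  · filter_upwards [hθ3] with z hz
    simp [hz]
  · filter_upwards [hθw] with z hz w hw
    have h := hz w
    rw [hw, zero_smul, add_zero] at h
    exact ⟨_, h⟩

omit [FiniteDimensional ℝ E] in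
/-- The value of a form on the bracket of two of its zeros depends only on the values of the
fields at the point. -/
theorem form_lieBracket_eq_zero {ι κ : Type*} [Finite ι] [Finite κ] {θ : E → E →L[ℝ] ℝ}
    {u : ι → E → E} {v : κ → E → E} {X Y : E → E} {m : E} {s : ι → ℝ} {t : κ → ℝ}
    (hθ : DifferentiableAt ℝ θ m) (hX : DifferentiableAt ℝ X m) (hY : DifferentiableAt ℝ Y m)
    (hu : ∀ i, DifferentiableAt ℝ (u i) m) (hv : ∀ j, DifferentiableAt ℝ (v j) m)
    (hθX : ∀ᶠ z in 𝓝 m, θ z (X z) = 0) (hθY : ∀ᶠ z in 𝓝 m, θ z (Y z) = 0)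
    (hθu : ∀ i, ∀ᶠ z in 𝓝 m, θ z (u i z) = s i) (hθv : ∀ j, ∀ᶠ z in 𝓝 m, θ z (v j z) = t j)
    (hXu : X m ∈ Submodule.span ℝ (Set.range fun i => u i m))
    (hYv : Y m ∈ Submodule.span ℝ (Set.range fun j => v j m))
    (h : ∀ i j, θ m (VectorField.lieBracket ℝ (u i) (v j) m) = 0) :
    θ m (VectorField.lieBracket ℝ X Y m) = 0 := by
  have := Fintype.ofFinite ι
  have := Fintype.ofFinite κ
  -- On fields where θ is locally constant, `form_lieBracket` expresses θ of a bracket through dθ,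
  -- which is bilinear in the values at the point; no derivatives of the coefficients occur.
  have huv : ∀ i j, fderiv ℝ θ m (v j m) (u i m) - fderiv ℝ θ m (u i m) (v j m) = 0 := by
    intro i j
    rw [← form_lieBracket hθ (hu i) (hv j) (hθu i) (hθv j), h]
  rw [form_lieBracket hθ hX hY hθX hθY]
  obtain ⟨c, hc⟩ := (Submodule.mem_span_range_iff_exists_fun ℝ).1 hXu
  obtain ⟨d, hd⟩ := (Submodule.mem_span_range_iff_exists_fun ℝ).1 hYv
  rw [← hc, ← hd]
  simp only [map_sum, map_smul, sum_apply, smul_apply, smul_eq_mul]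
  simp only [Finset.mul_sum]
  rw [Finset.sum_comm, ← Finset.sum_sub_distrib]
  refine Finset.sum_eq_zero fun j _ => ?_
  rw [← Finset.sum_sub_distrib]
  refine Finset.sum_eq_zero fun i _ => ?_
  linear_combination (c i * d j) * huv i j

end EngelCoordinates

/-! ### The Engel normal form for a frame in a vector space. -/

section EngelNormalForm

variable {E : Type*} [NormedAddCommGroup E] [NormedSpace ℝ E] [FiniteDimensional ℝ E]

/-- First integrals adapted to a flag satisfying the Engel conditions. -/
theorem exists_engel_first_integrals (b : Module.Basis (Fin 4) ℝ E) {e : Fin 3 → E → E} {m : E}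
    (he : ∀ i, ∀ᶠ z in 𝓝 m, ContDiffAt ℝ ∞ (e i) z) (hm : ∀ i, e i m = b i.castSucc)
    {α : E → E →L[ℝ] ℝ} (hα : ∀ᶠ z in 𝓝 m, ContDiffAt ℝ ∞ α z)
    (hαe : ∀ᶠ z in 𝓝 m, ∀ i, α z (e i z) = 0) (hα3 : α m (b 3) ≠ 0)
    (hαk : ∀ᶠ z in 𝓝 m, ∀ w, α z w = 0 → ∃ c : Fin 3 → ℝ, w = ∑ i, c i • e i z)
    (h12 : ∀ᶠ z in 𝓝 m, α z (VectorField.lieBracket ℝ (e 0) (e 1) z) = 0)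
    (h13 : ∀ᶠ z in 𝓝 m, α z (VectorField.lieBracket ℝ (e 0) (e 2) z) = 0) :
    ∃ x y : E → ℝ, (∀ᶠ z in 𝓝 m, ContDiffAt ℝ ∞ x z) ∧ (∀ᶠ z in 𝓝 m, ContDiffAt ℝ ∞ y z) ∧
      (∀ᶠ z in 𝓝 m, fderiv ℝ x z (e 0 z) = 0) ∧ (∀ᶠ z in 𝓝 m, fderiv ℝ y z (e 0 z) = 0) ∧
      fderiv ℝ x m (e 1 m) = 1 ∧
      ∀ᶠ z in 𝓝 m, ∀ w, fderiv ℝ x z w = 0 → fderiv ℝ y z w = 0 → α z w = 0 := by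
  let ε : Fin 4 → E →L[ℝ] ℝ := fun i => LinearMap.toContinuousLinearMap (b.coord i)
  have hε : ∀ i j, ε i (b j) = if i = j then 1 else 0 := by
    intro i j
    simp [ε, Finsupp.single_apply, eq_comm]
  -- The bracket conditions say that `e 0` is a Cauchy characteristic of α.
  have hd : ∀ᶠ z in 𝓝 m, ∀ w, α z w = 0 →
      fderiv ℝ α z (e 0 z) w = fderiv ℝ α z w (e 0 z) := by
    filter_upwards [hα, Filter.eventually_all.2 he, hαe.eventually_nhds, hαk, h12, h13]
      with z h1 h2 h3 h4 h5 h6 w hw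
    have key : ∀ i, α z (VectorField.lieBracket ℝ (e 0) (e i) z) =
        fderiv ℝ α z (e i z) (e 0 z) - fderiv ℝ α z (e 0 z) (e i z) := fun i =>
      form_lieBracket (h1.differentiableAt (by simp)) ((h2 0).differentiableAt (by simp))
        ((h2 i).differentiableAt (by simp)) (h3.mono fun u hu => hu 0) (h3.mono fun u hu => hu i)
    have k1 := key 1
    have k2 := key 2
    rw [h5] at k1
    rw [h6] at k2
    obtain ⟨c, rfl⟩ := h4 w hw
    simp only [Fin.sum_univ_three, map_add, map_smul, add_apply, smul_apply, smul_eq_mul]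
    linear_combination c 1 * k1 + c 2 * k2
  have e0 : e 0 m = b 0 := hm 0
  have e1 : e 1 m = b 1 := hm 1
  have e2 : e 2 m = b 2 := hm 2
  -- The distribution dx = dy = 0 is started along `e 0` and `e 2`, leaving out `e 1`; with dx = `ε
  -- 1` at m this makes dx(`e 1`) equal to 1 there.
  obtain ⟨x, y, hx, hy, hx0, hy0, hxm, -, hxy⟩ := exists_first_integrals (b := b 2) (c := b 3)
    (he 0) hα (hαe.mono fun z hz => hz 0) hd (ε 0) (ε 1) (ε 3) (ε 2)
    (by simp [e0, hε]) (by simp [hε]) (by simp [hε]) (by rw [← e2]; exact hαe.self_of_nhds 2)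
    hα3 (by simp [hε]) (by simp [e0, hε]) (by simp [e0, hε]) (by
      intro w h1 h3
      refine ⟨ε 0 w, ε 2 w, ?_⟩
      have h := b.sum_repr w
      rw [Fin.sum_univ_four] at h
      have h1' : b.repr w 1 = 0 := h1
      have h3' : b.repr w 3 = 0 := h3
      rw [h1', h3', zero_smul, zero_smul, add_zero, add_zero] at h
      rw [e0]
      exact h.symm)
  exact ⟨x, y, hx, hy, hx0, hy0, by simp [hxm, e1, hε], hxy⟩

/-- The Engel normal form: a flag satisfying the bracket conditions has canonical coordinates. -/
theorem exists_isEngelChart (b : Module.Basis (Fin 4) ℝ E) {e : Fin 3 → E → E} {m : E}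
    (he : ∀ i, ∀ᶠ z in 𝓝 m, ContDiffAt ℝ ∞ (e i) z) (hm : ∀ i, e i m = b i.castSucc)
    (h12 : ∀ᶠ z in 𝓝 m, VectorField.lieBracket ℝ (e 0) (e 1) z ∈
      Submodule.span ℝ (Set.range fun i => e i z))
    (h13 : ∀ᶠ z in 𝓝 m, VectorField.lieBracket ℝ (e 0) (e 2) z ∈
      Submodule.span ℝ (Set.range fun i => e i z))
    (n12 : VectorField.lieBracket ℝ (e 0) (e 1) m ∉
      Submodule.span ℝ (Set.range fun i : Fin 2 => e i.castSucc m))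
    (n23 : VectorField.lieBracket ℝ (e 1) (e 2) m ∉
      Submodule.span ℝ (Set.range fun i => e i m)) :
    ∃ x y p q : E → ℝ, IsEngelChart (e 0) (e 1) (e 2) m x y p q := by
  obtain ⟨α, hα, hαe, hα3, hαk⟩ := exists_annihilating_form b he hm
  have hspan : ∀ᶠ z in 𝓝 m, ∀ w ∈ Submodule.span ℝ (Set.range fun i => e i z), α z w = 0 := by
    filter_upwards [hαe] with z hz w hw
    obtain ⟨c, rfl⟩ := (Submodule.mem_span_range_iff_exists_fun ℝ).1 hw
    simp [hz]
  obtain ⟨x, y, hx, hy, hx0, hy0, hx1, hxy⟩ := exists_engel_first_integrals b he hm hα hαe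
    (by rw [hα3.self_of_nhds]; exact one_ne_zero) hαk
    (by filter_upwards [hspan, h12] with z h1 h2 using h1 _ h2)
    (by filter_upwards [hspan, h13] with z h1 h2 using h1 _ h2)
  have hsm : ∀ {f : E → ℝ} {v : E → E}, (∀ᶠ z in 𝓝 m, ContDiffAt ℝ ∞ f z) →
      (∀ᶠ z in 𝓝 m, ContDiffAt ℝ ∞ v z) →
      ∀ᶠ z in 𝓝 m, ContDiffAt ℝ ∞ (fun z => fderiv ℝ f z (v z)) z := by
    intro f v hf hv
    filter_upwards [hf, hv] with z h1 h2
    exact (h1.fderiv_right (m := ∞) (by simp)).clm_apply h2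
  have hne : ∀ᶠ z in 𝓝 m, fderiv ℝ x z (e 1 z) ≠ 0 :=
    (hsm hx (he 1)).self_of_nhds.continuousAt.eventually_ne (by rw [hx1]; exact one_ne_zero)
  let p : E → ℝ := fun z => fderiv ℝ y z (e 1 z) / fderiv ℝ x z (e 1 z)
  have hp : ∀ᶠ z in 𝓝 m, ContDiffAt ℝ ∞ p z := by
    filter_upwards [hsm hx (he 1), hsm hy (he 1), hne] with z h1 h2 h3 using h2.div h1 h3
  let q : E → ℝ := fun z => fderiv ℝ p z (e 1 z) / fderiv ℝ x z (e 1 z)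
  have hq : ∀ᶠ z in 𝓝 m, ContDiffAt ℝ ∞ q z := by
    filter_upwards [hsm hx (he 1), hsm hp (he 1), hne] with z h1 h2 h3 using h2.div h1 h3
  have hy1 : ∀ᶠ z in 𝓝 m, fderiv ℝ y z (e 1 z) = p z * fderiv ℝ x z (e 1 z) := by
    filter_upwards [hne] with z hz using (div_mul_cancel₀ _ hz).symm
  have hp1 : ∀ᶠ z in 𝓝 m, fderiv ℝ p z (e 1 z) = q z * fderiv ℝ x z (e 1 z) := by
    filter_upwards [hne] with z hz using (div_mul_cancel₀ _ hz).symm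
  -- Subtracting the right multiple of `e 1` from `w` makes both dx and dy vanish, and α vanishes on
  -- `e 1`.
  have hker : ∀ᶠ z in 𝓝 m, ∀ w, fderiv ℝ y z w = p z * fderiv ℝ x z w → α z w = 0 := by
    filter_upwards [hxy, hy1, hne, hαe] with z h1 h2 h3 h4 w hw
    have h5 := h1 (w - (fderiv ℝ x z w / fderiv ℝ x z (e 1 z)) • e 1 z)
      (by simp [h3]) (by
        rw [map_sub, map_smul, h2, hw, smul_eq_mul]
        field_simp
        ring)
    simpa [h4] using h5
  -- Otherwise `b 3`, corrected by a multiple of `e 2`, would be a zero of dy - p dx and so of α,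
  -- although α is 1 on it.
  have hy2 : ∀ᶠ z in 𝓝 m, fderiv ℝ y z (e 2 z) = p z * fderiv ℝ x z (e 2 z) := by
    filter_upwards [hker, hα3, hαe] with z h1 h2 h3
    by_contra h4
    have h5 : fderiv ℝ y z (e 2 z) - p z * fderiv ℝ x z (e 2 z) ≠ 0 := sub_ne_zero.2 h4
    have h6 := h1 (b 3 - ((fderiv ℝ y z (b 3) - p z * fderiv ℝ x z (b 3)) /
      (fderiv ℝ y z (e 2 z) - p z * fderiv ℝ x z (e 2 z))) • e 2 z) (by
        simp only [map_sub, map_smul, smul_eq_mul]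
        field_simp
        ring)
    rw [map_sub, map_smul, h3, h2] at h6
    simp at h6
  have hde : ∀ i, ∀ᶠ z in 𝓝 m, DifferentiableAt ℝ (e i) z := fun i =>
    (he i).mono fun z hz => hz.differentiableAt (by simp)
  have hy0' : ∀ᶠ z in 𝓝 m, fderiv ℝ y z (e 0 z) = p z * fderiv ℝ x z (e 0 z) := by
    filter_upwards [hx0, hy0] with z h1 h2
    rw [h1, h2, mul_zero]
  have hp0 : ∀ᶠ z in 𝓝 m, fderiv ℝ p z (e 0 z) = 0 := by
    filter_upwards [hx, hy, hp, hde 0, hde 1, hy0'.eventually_nhds, hy1.eventually_nhds,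
      h12, hx0, hne, hy2] with z h1 h2 h3 h4 h5 h6 h7 h8 h9 h10 h11
    have h := contact_lieBracket h1 h2 h3 h4 h5 h6 h7
    obtain ⟨c, hc⟩ := (Submodule.mem_span_range_iff_exists_fun ℝ).1 h8
    rw [← hc] at h
    simp only [Fin.sum_univ_three, map_add, map_smul, smul_eq_mul, h6.self_of_nhds,
      h7.self_of_nhds, h11, h9] at h
    have h' : fderiv ℝ p z (e 0 z) * fderiv ℝ x z (e 1 z) = 0 := by linear_combination -h
    exact (mul_eq_zero.1 h').resolve_right h10
  have hp0' : ∀ᶠ z in 𝓝 m, fderiv ℝ p z (e 0 z) = q z * fderiv ℝ x z (e 0 z) := by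
    filter_upwards [hx0, hp0] with z h1 h2
    rw [h1, h2, mul_zero]
  have hx1' := hne.self_of_nhds
  -- The value of dy - p dx on [`e 1`, `e 2`] is -dx(`e 1`) times this number; if it were 0, the
  -- bracket would lie in T³.
  have hη : fderiv ℝ p m (e 2 m) - q m * fderiv ℝ x m (e 2 m) ≠ 0 := by
    intro h0
    have h := contact_lieBracket hx.self_of_nhds hy.self_of_nhds hp.self_of_nhds
      (hde 1).self_of_nhds (hde 2).self_of_nhds hy1 hy2
    refine n23 ?_
    obtain ⟨c, hc⟩ := hαk.self_of_nhds _ (hker.self_of_nhds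
      (VectorField.lieBracket ℝ (e 1) (e 2) m) (by
        rw [hp1.self_of_nhds] at h
        linear_combination h - fderiv ℝ x m (e 1 m) * h0))
    exact (Submodule.mem_span_range_iff_exists_fun ℝ).2 ⟨c, hc.symm⟩
  -- The same formula for dp - q dx, in place of dy - p dx, on `e 0` and `e 1`: it equates dq(`e 0`)
  -- dx(`e 1`) with the `e 2`-coefficient of the bracket times the number in `hη`. The coefficient
  -- is nonzero by `n12`.
  have hq0 : fderiv ℝ q m (e 0 m) ≠ 0 := by
    intro h0
    have h := contact_lieBracket hx.self_of_nhds hp.self_of_nhds hq.self_of_nhds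
      (hde 0).self_of_nhds (hde 1).self_of_nhds hp0' hp1
    obtain ⟨c, hc⟩ := (Submodule.mem_span_range_iff_exists_fun ℝ).1 h12.self_of_nhds
    have hc2 : c 2 ≠ 0 := by
      intro h2
      refine n12 ((Submodule.mem_span_range_iff_exists_fun ℝ).2 ⟨fun i => c i.castSucc, ?_⟩)
      rw [← hc, Fin.sum_univ_castSucc (n := 2), show c (Fin.last 2) = 0 from h2, zero_smul,
        add_zero]
    rw [← hc, h0] at h
    simp only [Fin.sum_univ_three, map_add, map_smul, smul_eq_mul, hp0.self_of_nhds,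
      hp1.self_of_nhds, hx0.self_of_nhds] at h
    exact mul_ne_zero hc2 hη (by linear_combination h)
  refine ⟨x, y, p, q, hx, hy, hp, hq, hx0, hy0, hp0, hy1, hp1, hy2, fun w h1 h2 h3 h4 => ?_⟩
  obtain ⟨c, hc⟩ := hαk.self_of_nhds w (hker.self_of_nhds w (by rw [h1, h2, mul_zero]))
  rw [Fin.sum_univ_three] at hc
  rw [hc] at h1 h3 h4
  simp only [map_add, map_smul, smul_eq_mul, hp0.self_of_nhds, hx0.self_of_nhds,
    hp1.self_of_nhds] at h1 h3 h4
  have c2 : c 2 = 0 := by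
    have : c 2 * (fderiv ℝ p m (e 2 m) - q m * fderiv ℝ x m (e 2 m)) = 0 := by
      linear_combination h3 - q m * h1
    exact (mul_eq_zero.1 this).resolve_right hη
  have c1 : c 1 = 0 := by
    rw [c2] at h1
    have : c 1 * fderiv ℝ x m (e 1 m) = 0 := by linear_combination h1
    exact (mul_eq_zero.1 this).resolve_right hx1'
  have c0 : c 0 = 0 := by
    rw [c1, c2] at h4
    have : c 0 * fderiv ℝ q m (e 0 m) = 0 := by linear_combination h4
    exact (mul_eq_zero.1 this).resolve_right hq0
  rw [hc, c0, c1, c2]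
  simp

end EngelNormalForm

/-! ### Vector fields and brackets in charts; global sections. -/

section Charts

variable {M : Type*} [TopologicalSpace M] [ChartedSpace (EuclideanSpace ℝ (Fin 4)) M]
  [IsManifold (𝓡 4) ∞ M]

/-- The expression of a vector field in the chart at `x`. -/
noncomputable def chartField (x : M) (V : VField M) :
    EuclideanSpace ℝ (Fin 4) → EuclideanSpace ℝ (Fin 4) :=
  VectorField.mpullback (𝓡 4) (𝓡 4) (extChartAt (𝓡 4) x).symm V

theorem contMDiffAt_chart_symm (x : M) {z : EuclideanSpace ℝ (Fin 4)}
    (hz : z ∈ (extChartAt (𝓡 4) x).target) :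
    ContMDiffAt (𝓡 4) (𝓡 4) ∞ (extChartAt (𝓡 4) x).symm z :=
  (contMDiffOn_extChartAt_symm x).contMDiffAt ((isOpen_extChartAt_target x).mem_nhds hz)

theorem isInvertible_mfderiv_chart_symm (x : M) {z : EuclideanSpace ℝ (Fin 4)}
    (hz : z ∈ (extChartAt (𝓡 4) x).target) :
    (mfderiv (𝓡 4) (𝓡 4) (extChartAt (𝓡 4) x).symm z).IsInvertible := by
  have : IsManifold (𝓡 4) 1 M := .of_le (n := ∞) (by simp)
  have h := isInvertible_mfderivWithin_extChartAt_symm (I := 𝓡 4) hz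
  rwa [ModelWithCorners.Boundaryless.range_eq_univ, mfderivWithin_univ] at h

/-- The derivative of the chart at `x`, as a map to the model space. -/
noncomputable def chartDeriv (x y : M) : TangentSpace (𝓡 4) y →ₗ[ℝ] EuclideanSpace ℝ (Fin 4) :=
  (mfderiv (𝓡 4) (𝓡 4) (extChartAt (𝓡 4) x) y).toLinearMap

theorem chartDeriv_apply (x : M) {z : EuclideanSpace ℝ (Fin 4)}
    (hz : z ∈ (extChartAt (𝓡 4) x).target) (V : VField M) :
    chartDeriv x ((extChartAt (𝓡 4) x).symm z) (V ((extChartAt (𝓡 4) x).symm z)) =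
      chartField x V z := by
  have : IsManifold (𝓡 4) 1 M := .of_le (n := ∞) (by simp)
  have h := mfderivWithin_extChartAt_symm_comp_mfderiv_extChartAt (I := 𝓡 4) hz
  rw [ModelWithCorners.Boundaryless.range_eq_univ, mfderivWithin_univ] at h
  have h' := congrArg (fun B => B (V ((extChartAt (𝓡 4) x).symm z))) h
  symm
  exact ((isInvertible_mfderiv_chart_symm x hz).inverse_apply_eq).2 h'.symm

theorem chartDeriv_injective (x : M) {y : M} (hy : y ∈ (extChartAt (𝓡 4) x).source) :
    Function.Injective (chartDeriv x y) := by
  have : IsManifold (𝓡 4) 1 M := .of_le (n := ∞) (by simp)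
  exact (isInvertible_mfderiv_extChartAt (I := 𝓡 4) hy).injective

theorem contDiffAt_chartField (x : M) {V : VField M} {z : EuclideanSpace ℝ (Fin 4)}
    (hz : z ∈ (extChartAt (𝓡 4) x).target)
    (hV : ContMDiffAt (𝓡 4) (𝓡 4).tangent ∞
      (fun y => (⟨y, V y⟩ : TangentBundle (𝓡 4) M)) ((extChartAt (𝓡 4) x).symm z)) :
    ContDiffAt ℝ ∞ (chartField x V) z := by
  have : IsManifold (𝓡 4) 1 M := .of_le (n := ∞) (by simp)
  have h := ContMDiffAt.mpullback_vectorField_preimage (n := ∞) hV (contMDiffAt_chart_symm x hz)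
    (isInvertible_mfderiv_chart_symm x hz) (by simp)
  exact contMDiffAt_vectorSpace_iff_contDiffAt.1 h

/-- Lie brackets commute with pullback along the inverse chart, and in the model space the manifold
bracket is the ordinary one. -/
theorem chartField_mlieBracket (x : M) {V W : VField M} {z : EuclideanSpace ℝ (Fin 4)}
    (hz : z ∈ (extChartAt (𝓡 4) x).target)
    (hV : SmoothVFieldOn V Set.univ) (hW : SmoothVFieldOn W Set.univ) :
    chartField x (VectorField.mlieBracket (𝓡 4) V W) z =
      VectorField.lieBracket ℝ (chartField x V) (chartField x W) z := by
  have : IsManifold (𝓡 4) (minSmoothness ℝ 3) M := .of_le (n := ∞) (by simpa using ENat.LEInfty.out)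
  have : IsManifold (𝓡 4) 1 M := .of_le (n := ∞) (by simp)
  have hd : ∀ {V : VField M}, SmoothVFieldOn V Set.univ → MDifferentiableAt (𝓡 4) (𝓡 4).tangent
      (fun y => (⟨y, V y⟩ : TangentBundle (𝓡 4) M)) ((extChartAt (𝓡 4) x).symm z) := fun h =>
    (contMDiffOn_univ.1 h _).mdifferentiableAt (by simp)
  have h := VectorField.mpullback_mlieBracket (n := ∞) (hd hV) (hd hW)
    (contMDiffAt_chart_symm x hz) (by simpa using ENat.LEInfty.out)
  refine h.trans ?_
  rw [← VectorField.mlieBracketWithin_univ, ← VectorField.lieBracketWithin_univ]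
  exact congrFun VectorField.mlieBracketWithin_eq_lieBracketWithin z

variable [T2Space M]

theorem exists_bump {U : Set M} (hU : IsOpen U) {x : M} (hx : x ∈ U) :
    ∃ χ : M → ℝ, ContMDiff (𝓡 4) 𝓘(ℝ, ℝ) ∞ χ ∧ tsupport χ ⊆ U ∧ ∀ᶠ y in 𝓝 x, χ y = 1 := by
  obtain ⟨f, -, hf⟩ := (SmoothBumpFunction.nhds_basis_tsupport (I := 𝓡 4) x).mem_iff.1
    (hU.mem_nhds hx)
  exact ⟨f, f.contMDiff, hf, f.eventuallyEq_one⟩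

/-- A section of `T` on an open set agrees near each point of it with a global section of `T`. -/
theorem exists_global_section {T : TangentField M} {U : Set M} (hU : IsOpen U) {x : M} (hx : x ∈ U)
    {V : VField M} (hV : SmoothVFieldOn V U) (hVT : ∀ y ∈ U, V y ∈ T y) :
    ∃ W ∈ smoothSections T, ∀ᶠ y in 𝓝 x, W y = V y := by
  obtain ⟨χ, hχ, hχU, hχ1⟩ := exists_bump hU hx
  refine ⟨χ • V, ⟨contMDiffOn_univ.2
    (ContMDiffOn.smul_section_of_tsupport hχ.contMDiffOn hU hχU hV), fun y => ?_⟩, ?_⟩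
  · by_cases hy : y ∈ U
    · exact (T y).smul_mem _ (hVT y hy)
    · have : χ y = 0 := image_eq_zero_of_notMem_tsupport fun h => hy (hχU h)
      change χ y • V y ∈ T y
      rw [this, zero_smul]
      exact zero_mem _
  · filter_upwards [hχ1] with y hy
    change χ y • V y = V y
    rw [hy, one_smul]

/-- A local frame is cut off by bump functions, because the bracket conditions speak only of global
sections. -/
theorem IsSmoothSubbundle.exists_global_frame {T : TangentField M} {k : ℕ}
    (hT : IsSmoothSubbundle T k) (x : M) :
    ∃ e : Fin k → VField M, (∀ i, e i ∈ smoothSections T) ∧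
      LinearIndependent ℝ (fun i => e i x) ∧ Submodule.span ℝ (Set.range fun i => e i x) = T x := by
  obtain ⟨U, hU, hx, e, he, heT⟩ := hT x
  have h : ∀ i, ∃ W ∈ smoothSections T, ∀ᶠ y in 𝓝 x, W y = e i y := fun i =>
    exists_global_section hU hx (he i) fun y hy => by
      rw [← (heT y hy).2]
      exact Submodule.subset_span ⟨i, rfl⟩
  choose W hW hWe using h
  have : (fun i => W i x) = fun i => e i x := funext fun i => (hWe i).self_of_nhds
  exact ⟨W, hW, this ▸ (heT x hx).1, this ▸ (heT x hx).2⟩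

omit [T2Space M] in
theorem IsSmoothSubbundle.finrank_eq {T : TangentField M} {k : ℕ}
    (hT : IsSmoothSubbundle T k) (x : M) : Module.finrank ℝ (T x) = k := by
  obtain ⟨U, hU, hx, e, he, heT⟩ := hT x
  rw [← (heT x hx).2, finrank_span_eq_card (heT x hx).1, Fintype.card_fin]

/-- A tangent vector extends to a smooth vector field. -/
theorem exists_chartField_eq (x : M) (u : EuclideanSpace ℝ (Fin 4)) :
    ∃ W : VField M, SmoothVFieldOn W Set.univ ∧ chartField x W (extChartAt (𝓡 4) x x) = u := by
  have : IsManifold (𝓡 4) 1 M := .of_le (n := ∞) (by simp)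
  let c : VField (EuclideanSpace ℝ (Fin 4)) := fun _ => u
  have hc : SmoothVFieldOn c Set.univ :=
    JetTwo.smoothVFieldOn_of_contDiff (fun _ => u) contDiff_const _
  let V : VField M := VectorField.mpullback (𝓡 4) (𝓡 4) (extChartAt (𝓡 4) x) c
  have hV : SmoothVFieldOn V (chartAt (EuclideanSpace ℝ (Fin 4)) x).source := by
    intro y hy
    refine (ContMDiffAt.mpullback_vectorField_preimage (n := ∞) (contMDiffOn_univ.1 hc _)
      (contMDiffAt_extChartAt' hy) (isInvertible_mfderiv_extChartAt (by simpa using hy))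
      (by simp)).contMDiffWithinAt
  obtain ⟨W, hW, hWV⟩ := exists_global_section (T := fun _ => ⊤)
    (chartAt (EuclideanSpace ℝ (Fin 4)) x).open_source (mem_chart_source _ x) hV
    (fun _ _ => trivial)
  have hWV' : W ((extChartAt (𝓡 4) x).symm (extChartAt (𝓡 4) x x)) =
      V ((extChartAt (𝓡 4) x).symm (extChartAt (𝓡 4) x x)) := by
    rw [extChartAt_to_inv]; exact hWV.self_of_nhds
  refine ⟨W, hW.1, ?_⟩
  have hm := mem_extChartAt_target (I := 𝓡 4) x
  rw [← chartDeriv_apply x hm, hWV']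
  have hi := isInvertible_mfderiv_extChartAt (I := 𝓡 4) ((extChartAt (𝓡 4) x).map_target hm)
  exact ((hi.inverse_apply_eq).1 rfl).symm

end Charts

/-! ### Dimension counts and extension of independent families. -/

section LinearAlgebra

variable {V : Type*} [AddCommGroup V] [Module ℝ V]

theorem span_range_eq_of_finrank [FiniteDimensional ℝ V] {T : Submodule ℝ V} {k : ℕ} {v : Fin k → V}
    (hv : LinearIndependent ℝ v) (hT : ∀ i, v i ∈ T) (hk : Module.finrank ℝ T = k) :
    Submodule.span ℝ (Set.range v) = T :=
  Submodule.eq_of_le_of_finrank_eq (Submodule.span_le.2 (by rintro _ ⟨i, rfl⟩; exact hT i))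
    (by rw [finrank_span_eq_card hv, hk, Fintype.card_fin])

/-- If no `e i` enlarged the family, the span of `e` would lie in that of `v`, of smaller dimension.
The new vector is taken from `e` itself, so a frame can grow inside a given bundle. -/
theorem LinearIndependent.exists_snoc {k n : ℕ}
    {v : Fin k → V} (hv : LinearIndependent ℝ v)
    {e : Fin n → V} (he : LinearIndependent ℝ e) (hkn : k < n) :
    ∃ i, LinearIndependent ℝ (Fin.snoc v (e i) : Fin (k + 1) → V) := by
  by_contra! h
  have h1 : ∀ i, e i ∈ Submodule.span ℝ (Set.range v) := fun i => by
    by_contra h2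
    exact h i (linearIndependent_finSnoc.2 ⟨hv, h2⟩)
  have h3 : Submodule.span ℝ (Set.range e) ≤ Submodule.span ℝ (Set.range v) :=
    Submodule.span_le.2 (by rintro _ ⟨i, rfl⟩; exact h1 i)
  have : FiniteDimensional ℝ (Submodule.span ℝ (Set.range v)) :=
    FiniteDimensional.span_of_finite ℝ (Set.finite_range v)
  have h4 := Submodule.finrank_mono h3
  rw [finrank_span_eq_card he, finrank_span_eq_card hv, Fintype.card_fin, Fintype.card_fin] at h4
  omega

end LinearAlgebra

/-! ### Adapted frames and forms on bracket modules. -/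

section EngelFrame

variable {M : Type*} [TopologicalSpace M] [ChartedSpace (EuclideanSpace ℝ (Fin 4)) M]
  [IsManifold (𝓡 4) ∞ M]

instance (x : M) : FiniteDimensional ℝ (TangentSpace (𝓡 4) x) :=
  inferInstanceAs (FiniteDimensional ℝ (EuclideanSpace ℝ (Fin 4)))

/-- A frame of sections of the three bundles of a filtration, adapted to it near a point. -/
theorem TangentFiltration.exists_adapted_frame [T2Space M] (F : TangentFiltration M) (x : M) :
    ∃ s : Fin 3 → VField M, s 0 ∈ smoothSections F.T1 ∧ s 1 ∈ smoothSections F.T2 ∧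
      s 2 ∈ smoothSections F.T3 ∧ LinearIndependent ℝ (fun i => s i x) := by
  obtain ⟨e, he, hei, -⟩ := F.smooth1.exists_global_frame x
  obtain ⟨f, hf, hfi, -⟩ := F.smooth2.exists_global_frame x
  obtain ⟨g, hg, hgi, -⟩ := F.smooth3.exists_global_frame x
  obtain ⟨i, hi⟩ := hei.exists_snoc hfi (by norm_num)
  obtain ⟨j, hj⟩ := hi.exists_snoc hgi (by norm_num)
  refine ⟨![e 0, f i, g j], he 0, hf i, hg j, ?_⟩
  convert! hj using 1
  funext k
  fin_cases k <;> rfl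

theorem mem_smoothSections_of_le {S T : TangentField M} (h : ∀ x, S x ≤ T x) {V : VField M}
    (hV : V ∈ smoothSections S) : V ∈ smoothSections T :=
  ⟨hV.1, fun x => h x (hV.2 x)⟩

theorem mlieBracket_mem_bracketModule {S T : TangentField M} {X Y : VField M}
    (hX : X ∈ smoothSections S) (hY : Y ∈ smoothSections T) :
    VectorField.mlieBracket (𝓡 4) X Y ∈ bracketModule S T :=
  ⟨1, fun _ _ => 1, fun _ => X, fun _ => Y, fun _ => contMDiff_const, fun _ => hX, fun _ => hY,
    fun x => by simp⟩

omit [IsManifold (𝓡 4) ∞ M] in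
theorem eventually_mem_chart_target (x : M) :
    ∀ᶠ z in 𝓝 (extChartAt (𝓡 4) x x), z ∈ (extChartAt (𝓡 4) x).target :=
  (isOpen_extChartAt_target x).mem_nhds (mem_extChartAt_target x)

theorem linearIndependent_of_chartField (x : M) {ι : Type*} {s : ι → VField M}
    {z : EuclideanSpace ℝ (Fin 4)} (hz : z ∈ (extChartAt (𝓡 4) x).target) :
    LinearIndependent ℝ (fun i => chartField x (s i) z) ↔
      LinearIndependent ℝ (fun i => s i ((extChartAt (𝓡 4) x).symm z)) := by
  have hinj := chartDeriv_injective x ((extChartAt (𝓡 4) x).map_target hz)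
  have h : (fun i => chartField x (s i) z) =
      chartDeriv x ((extChartAt (𝓡 4) x).symm z) ∘
        fun i => s i ((extChartAt (𝓡 4) x).symm z) :=
    funext fun i => (chartDeriv_apply x hz (s i)).symm
  rw [h]
  exact LinearMap.linearIndependent_iff_of_injOn _ hinj.injOn

theorem linearIndependent_chartField_base (x : M) {ι : Type*} {s : ι → VField M}
    (h : LinearIndependent ℝ (fun i => s i x)) :
    LinearIndependent ℝ (fun i => chartField x (s i) (extChartAt (𝓡 4) x x)) := by
  rw [linearIndependent_of_chartField x (mem_extChartAt_target x), extChartAt_to_inv]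
  exact h

/-- Linear independence is an open condition and the chart expressions are continuous. -/
theorem eventually_linearIndependent_chartField (x : M) {s : Fin 3 → VField M}
    (hs : ∀ i, SmoothVFieldOn (s i) Set.univ) (h : LinearIndependent ℝ (fun i => s i x)) :
    ∀ᶠ z in 𝓝 (extChartAt (𝓡 4) x x), LinearIndependent ℝ (fun i => chartField x (s i) z) := by
  have hm := mem_extChartAt_target (I := 𝓡 4) x
  have hc : ContinuousAt (fun z i => chartField x (s i) z) (extChartAt (𝓡 4) x x) :=
    continuousAt_pi.2 fun i =>
      (contDiffAt_chartField x hm (contMDiffOn_univ.1 (hs i) _)).continuousAt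
  exact hc (isOpen_setOfPred_linearIndependent.mem_nhds (linearIndependent_chartField_base x h))

/-- A bundle of a filtration is spanned near a point by an initial piece of an adapted frame. -/
theorem eventually_span_frame (x : M) {s : Fin 3 → VField M}
    (hs : ∀ i, SmoothVFieldOn (s i) Set.univ) (h : LinearIndependent ℝ (fun i => s i x))
    {T : TangentField M} {k : ℕ} (hk : k ≤ 3) (hT : IsSmoothSubbundle T k)
    (hsT : ∀ (i : Fin k) y, s (i.castLE hk) y ∈ T y) :
    ∀ᶠ z in 𝓝 (extChartAt (𝓡 4) x x),
      Submodule.span ℝ (Set.range fun i : Fin k =>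
        s (i.castLE hk) ((extChartAt (𝓡 4) x).symm z)) = T ((extChartAt (𝓡 4) x).symm z) := by
  filter_upwards [eventually_linearIndependent_chartField x hs h, eventually_mem_chart_target x]
    with z h1 hz
  have h2 := ((linearIndependent_of_chartField x hz).1 h1).comp (Fin.castLE hk)
    (Fin.castLE_injective hk)
  exact span_range_eq_of_finrank h2 (fun i => hsT i _) (hT.finrank_eq _)

theorem chartField_mem_span (x : M) {ι : Type*} {s : ι → VField M} {V : VField M}
    {z : EuclideanSpace ℝ (Fin 4)} (hz : z ∈ (extChartAt (𝓡 4) x).target)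
    (h : V ((extChartAt (𝓡 4) x).symm z) ∈
      Submodule.span ℝ (Set.range fun i => s i ((extChartAt (𝓡 4) x).symm z))) :
    chartField x V z ∈ Submodule.span ℝ (Set.range fun i => chartField x (s i) z) := by
  have h1 := Submodule.mem_map_of_mem (f := chartDeriv x ((extChartAt (𝓡 4) x).symm z)) h
  rw [Submodule.map_span, ← Set.range_comp] at h1
  have h2 : (fun i => chartField x (s i) z) =
      chartDeriv x ((extChartAt (𝓡 4) x).symm z) ∘
        fun i => s i ((extChartAt (𝓡 4) x).symm z) :=
    funext fun i => (chartDeriv_apply x hz (s i)).symm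
  rw [h2, ← chartDeriv_apply x hz V]
  exact h1

/-- A form which annihilates all brackets of frame fields of two bundles annihilates the module
generated by the brackets of their sections. -/
theorem form_bracketModule_eq_zero (x : M) {ι κ : Type} [Finite ι] [Finite κ] {S T : TangentField M}
    {u : ι → VField M} {v : κ → VField M}
    (hu : ∀ i, SmoothVFieldOn (u i) Set.univ) (hv : ∀ i, SmoothVFieldOn (v i) Set.univ)
    (hS : ∀ᶠ z in 𝓝 (extChartAt (𝓡 4) x x), S ((extChartAt (𝓡 4) x).symm z) =
      Submodule.span ℝ (Set.range fun i => u i ((extChartAt (𝓡 4) x).symm z)))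
    (hT : ∀ᶠ z in 𝓝 (extChartAt (𝓡 4) x x), T ((extChartAt (𝓡 4) x).symm z) =
      Submodule.span ℝ (Set.range fun i => v i ((extChartAt (𝓡 4) x).symm z)))
    {θ : EuclideanSpace ℝ (Fin 4) → EuclideanSpace ℝ (Fin 4) →L[ℝ] ℝ}
    (hθ : DifferentiableAt ℝ θ (extChartAt (𝓡 4) x x))
    (hθu : ∀ᶠ z in 𝓝 (extChartAt (𝓡 4) x x), ∀ i, θ z (chartField x (u i) z) = 0)
    (hθv : ∀ᶠ z in 𝓝 (extChartAt (𝓡 4) x x), ∀ i, θ z (chartField x (v i) z) = 0)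
    (h : ∀ i j, θ (extChartAt (𝓡 4) x x) (VectorField.lieBracket ℝ (chartField x (u i))
      (chartField x (v j)) (extChartAt (𝓡 4) x x)) = 0)
    {Z : VField M} (hZ : Z ∈ bracketModule S T) :
    θ (extChartAt (𝓡 4) x x) (chartField x Z (extChartAt (𝓡 4) x x)) = 0 := by
  obtain ⟨n, f, X, Y, -, hX, hY, hZ'⟩ := hZ
  have hm := mem_extChartAt_target (I := 𝓡 4) x
  have hd : ∀ {V : VField M}, SmoothVFieldOn V Set.univ →
      DifferentiableAt ℝ (chartField x V) (extChartAt (𝓡 4) x x) := fun hV =>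
    (contDiffAt_chartField x hm (contMDiffOn_univ.1 hV _)).differentiableAt (by simp)
  have hmem : ∀ {ι : Type} {R : TangentField M} {w : ι → VField M} {V : VField M},
      (∀ᶠ z in 𝓝 (extChartAt (𝓡 4) x x), R ((extChartAt (𝓡 4) x).symm z) =
        Submodule.span ℝ (Set.range fun i => w i ((extChartAt (𝓡 4) x).symm z))) →
      (∀ y, V y ∈ R y) → ∀ᶠ z in 𝓝 (extChartAt (𝓡 4) x x),
        chartField x V z ∈ Submodule.span ℝ (Set.range fun i => chartField x (w i) z) := by
    intro ι R w V hR hV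
    filter_upwards [hR, eventually_mem_chart_target x] with z h1 h2
    exact chartField_mem_span x h2 (h1 ▸ hV _)
  have hker : ∀ {ι : Type} {w : ι → VField M} {V : VField M},
      (∀ᶠ z in 𝓝 (extChartAt (𝓡 4) x x), ∀ i, θ z (chartField x (w i) z) = 0) →
      (∀ᶠ z in 𝓝 (extChartAt (𝓡 4) x x),
        chartField x V z ∈ Submodule.span ℝ (Set.range fun i => chartField x (w i) z)) →
      ∀ᶠ z in 𝓝 (extChartAt (𝓡 4) x x), θ z (chartField x V z) = 0 := by
    intro ι w V hw hV
    filter_upwards [hw, hV] with z h1 h2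
    have h3 : Submodule.span ℝ (Set.range fun i => chartField x (w i) z) ≤
        LinearMap.ker (θ z).toLinearMap :=
      Submodule.span_le.2 (by rintro _ ⟨i, rfl⟩; exact h1 i)
    exact h3 h2
  -- The function coefficients come out as scalars at the point, so it suffices to treat single
  -- brackets of sections.
  rw [← chartDeriv_apply x hm, hZ', map_sum, map_sum]
  refine Finset.sum_eq_zero fun i _ => ?_
  rw [map_smul]
  have h1 := chartField_mlieBracket x hm (hX i).1 (hY i).1
  rw [chartDeriv_apply x hm, map_smul, h1]
  have hXi := hmem hS (hX i).2
  have hYi := hmem hT (hY i).2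
  rw [form_lieBracket_eq_zero (s := 0) (t := 0) hθ (hd (hX i).1) (hd (hY i).1)
    (fun i => hd (hu i)) (fun i => hd (hv i)) (hker hθu hXi) (hker hθv hYi)
    (fun i => hθu.mono fun z hz => hz i) (fun i => hθv.mono fun z hz => hz i)
    hXi.self_of_nhds hYi.self_of_nhds h, smul_zero]

end EngelFrame

/-! ### From the bracket conditions to Engel charts. -/

section EngelChart

variable {M : Type*} [TopologicalSpace M] [ChartedSpace (EuclideanSpace ℝ (Fin 4)) M]
  [IsManifold (𝓡 4) ∞ M]

/-- Near every point, a filtration satisfying the bracket conditions has a frame with an Engel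
chart. -/
theorem TangentFiltration.BracketConditions.exists_isEngelChart [T2Space M]
    {F : TangentFiltration M} (hF : F.BracketConditions) (x : M) :
    ∃ s : Fin 3 → VField M, (s 0 ∈ smoothSections F.T1 ∧ s 1 ∈ smoothSections F.T2 ∧
      s 2 ∈ smoothSections F.T3 ∧ LinearIndependent ℝ (fun i => s i x)) ∧
      ∃ x' y' p' q' : EuclideanSpace ℝ (Fin 4) → ℝ,
        IsEngelChart (chartField x (s 0)) (chartField x (s 1)) (chartField x (s 2))
          (extChartAt (𝓡 4) x x) x' y' p' q' := by
  obtain ⟨s, h0, h1, h2, hli⟩ := F.exists_adapted_frame x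
  refine ⟨s, ⟨h0, h1, h2, hli⟩, ?_⟩
  have hs : ∀ i, SmoothVFieldOn (s i) Set.univ := by
    intro i; fin_cases i <;> [exact h0.1; exact h1.1; exact h2.1]
  have h02 := mem_smoothSections_of_le F.le12 h0
  have h03 := mem_smoothSections_of_le F.le23 h02
  have h13 := mem_smoothSections_of_le F.le23 h1
  set m := extChartAt (𝓡 4) x x with hm
  let e : Fin 3 → EuclideanSpace ℝ (Fin 4) → EuclideanSpace ℝ (Fin 4) := fun i => chartField x (s i)
  have hmt := mem_extChartAt_target (I := 𝓡 4) x
  have htar := eventually_mem_chart_target x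
  have he : ∀ i, ∀ᶠ z in 𝓝 m, ContDiffAt ℝ ∞ (e i) z := by
    intro i
    filter_upwards [htar] with z hz
    exact contDiffAt_chartField x hz (contMDiffOn_univ.1 (hs i) _)
  have hei : LinearIndependent ℝ (fun i => e i m) := linearIndependent_chartField_base x hli
  -- A standard basis vector completes the frame at m to the basis `b`; it serves as the constant
  -- field transverse to T³.
  obtain ⟨k, hk⟩ := hei.exists_snoc
    (EuclideanSpace.basisFun (Fin 4) ℝ).toBasis.linearIndependent (by norm_num)
  let b := basisOfLinearIndependentOfCardEqFinrank hk (by simp)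
  have hb : ∀ i : Fin 3, e i m = b i.castSucc := by
    intro i
    simp only [b, coe_basisOfLinearIndependentOfCardEqFinrank, Fin.snoc_castSucc]
  obtain ⟨θ, hθ, hθe, hθ3, -⟩ := exists_coframe b he hb
  have hθd : ∀ k, DifferentiableAt ℝ (θ k) m := fun k =>
    (hθ k).self_of_nhds.differentiableAt (by simp)
  have sp1 := eventually_span_frame x hs hli (by norm_num) F.smooth1
    (by intro i; fin_cases i; exact h0.2)
  have sp2 := eventually_span_frame x hs hli (by norm_num) F.smooth2
    (by intro i; fin_cases i <;> [exact h02.2; exact h1.2])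
  have sp3 := eventually_span_frame x hs hli le_rfl F.smooth3
    (by intro i; fin_cases i <;> [exact h03.2; exact h13.2; exact h2.2])
  have hbr : ∀ i j, VectorField.mlieBracket (𝓡 4) (s i) (s j) ∈ smoothSections F.T3 →
      ∀ᶠ z in 𝓝 m, VectorField.lieBracket ℝ (e i) (e j) z ∈
        Submodule.span ℝ (Set.range fun i => e i z) := by
    intro i j h
    filter_upwards [htar, sp3] with z hz h3
    have h4 := h.2 ((extChartAt (𝓡 4) x).symm z)
    rw [← h3] at h4
    have h5 := chartField_mem_span x (s := s) hz h4
    rwa [chartField_mlieBracket x hz (hs i) (hs j)] at h5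
  have h12 := hbr 0 1 (by rw [← hF.bracket12]; exact mlieBracket_mem_bracketModule h0 h1)
  have h13' := hbr 0 2 (by rw [← hF.bracket13]; exact mlieBracket_mem_bracketModule h0 h2)
  have hspan : ∀ {ι : Type} {w : ι → EuclideanSpace ℝ (Fin 4)} {k : Fin 4},
      (∀ i, θ k m (w i) = 0) → ∀ v ∈ Submodule.span ℝ (Set.range w), θ k m v = 0 := by
    intro ι w k hw v hv
    have h3 : Submodule.span ℝ (Set.range w) ≤ LinearMap.ker (θ k m).toLinearMap :=
      Submodule.span_le.2 (by rintro _ ⟨i, rfl⟩; exact hw i)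
    exact h3 hv
  refine _root_.exists_isEngelChart b he hb h12 h13' ?_ ?_
  · intro h
    -- If the bracket lay in T² at the point, the form `θ 2` dual to `e 2` would vanish there on all
    -- of [Γ(T¹), Γ(T²)] = Γ(T³), which contains `s 2`.
    have hmod : s 2 ∈ bracketModule F.T1 F.T2 := by rw [hF.bracket12]; exact h2
    have hz := form_bracketModule_eq_zero x (fun i => hs _) (fun i => hs _)
      (sp1.mono fun z hz => hz.symm) (sp2.mono fun z hz => hz.symm) (hθd 2)
      (by
        filter_upwards [hθe] with z hz i
        refine (hz 2 _).trans (if_neg ?_)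
        fin_cases i; simp [Fin.ext_iff])
      (by
        filter_upwards [hθe] with z hz i
        refine (hz 2 _).trans (if_neg ?_)
        fin_cases i <;> simp [Fin.ext_iff])
      (by
        intro i j
        fin_cases i
        fin_cases j
        · change θ 2 m (VectorField.lieBracket ℝ (e 0) (e 0) m) = 0
          simp
        · refine hspan (fun i => ?_) _ h
          refine (hθe.self_of_nhds 2 _).trans (if_neg ?_)
          fin_cases i <;> simp [Fin.ext_iff]) hmod
    have h3 := hθe.self_of_nhds 2 2
    rw [show θ 2 m (e 2 m) = 0 from hz] at h3
    simp at h3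
  · intro h
    -- Likewise for T³: `θ 3` would vanish on all frame brackets, hence on every vector field,
    -- contrary to its value 1 on `b 3`.
    obtain ⟨W, hW, hWb⟩ := exists_chartField_eq x (b 3)
    have hmod : W ∈ bracketModule F.T3 F.T3 := by
      rw [hF.bracket33]; exact ⟨hW, fun _ => trivial⟩
    have hθe3 : ∀ᶠ z in 𝓝 m, ∀ i, θ 3 z (e i z) = 0 := by
      filter_upwards [hθe] with z hz i
      refine (hz 3 _).trans (if_neg ?_)
      fin_cases i <;> simp [Fin.ext_iff]
    have hθ0 : ∀ v ∈ Submodule.span ℝ (Set.range fun i => e i m), θ 3 m v = 0 :=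
      hspan hθe3.self_of_nhds
    have hswap : ∀ i j, θ 3 m (VectorField.lieBracket ℝ (e i) (e j) m) = 0 →
        θ 3 m (VectorField.lieBracket ℝ (e j) (e i) m) = 0 := by
      intro i j h
      rw [VectorField.lieBracket_swap, map_neg, h, neg_zero]
    have k01 := hθ0 _ h12.self_of_nhds
    have k02 := hθ0 _ h13'.self_of_nhds
    have k12 := hθ0 _ h
    have hz := form_bracketModule_eq_zero x hs hs
      (sp3.mono fun z hz => hz.symm) (sp3.mono fun z hz => hz.symm) (hθd 3) hθe3 hθe3
      (by
        intro i j
        change θ 3 m (VectorField.lieBracket ℝ (e i) (e j) m) = 0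
        fin_cases i <;> fin_cases j
        · simp
        · exact k01
        · exact k02
        · exact hswap _ _ k01
        · simp
        · exact k12
        · exact hswap _ _ k02
        · exact hswap _ _ k12
        · simp) hmod
    have h3 := hθ3.self_of_nhds 3
    rw [show θ 3 m (b 3) = 0 by rw [← hWb]; exact hz] at h3
    simp at h3

end EngelChart

/-! ### Local isomorphism is symmetric and transitive. -/

section LocalIsomorphism

variable {M : Type*} [TopologicalSpace M] [ChartedSpace (EuclideanSpace ℝ (Fin 4)) M]
  [IsManifold (𝓡 4) ∞ M]
  {N : Type*} [TopologicalSpace N] [ChartedSpace (EuclideanSpace ℝ (Fin 4)) N]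
  [IsManifold (𝓡 4) ∞ N]
  {P : Type*} [TopologicalSpace P] [ChartedSpace (EuclideanSpace ℝ (Fin 4)) P]
  [IsManifold (𝓡 4) ∞ P]

/-- The derivative of a map between `4`-manifolds, read in the model space. -/
noncomputable def modelDeriv (f : M → N) (z : M) :
    EuclideanSpace ℝ (Fin 4) →ₗ[ℝ] EuclideanSpace ℝ (Fin 4) :=
  (mfderiv (𝓡 4) (𝓡 4) f z).toLinearMap

/-- A field of tangent subspaces, read in the model space. -/
def modelField (T : TangentField M) (z : M) : Submodule ℝ (EuclideanSpace ℝ (Fin 4)) := T z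

/-- The map `f` takes the subspace of `S` at `z` to the subspace of `T` at `f z`. -/
def CarriesAt (f : M → N) (S : TangentField M) (T : TangentField N) (z : M) : Prop :=
  (modelField S z).map (modelDeriv f z) = modelField T (f z)

/-- Every tangent space is definitionally the model space, so the condition can be restated without
dependent types; composition and inversion are then plain linear algebra. -/
theorem locallyIsomorphicAt_iff {F : TangentFiltration M} {G : TangentFiltration N} {x : M}
    {y : N} : F.LocallyIsomorphicAt G x y ↔
      ∃ Φ : PartialDiffeomorph (𝓡 4) (𝓡 4) M N ∞, x ∈ Φ.source ∧ Φ x = y ∧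
        ∀ z ∈ Φ.source, CarriesAt Φ F.T1 G.T1 z ∧ CarriesAt Φ F.T2 G.T2 z ∧
          CarriesAt Φ F.T3 G.T3 z ∧ CarriesAt Φ F.T4 G.T4 z := Iff.rfl

omit [IsManifold (𝓡 4) ∞ M] [IsManifold (𝓡 4) ∞ N] [IsManifold (𝓡 4) ∞ P] in
theorem modelDeriv_comp {f : M → N} {g : N → P} {z : M}
    (hg : MDifferentiableAt (𝓡 4) (𝓡 4) g (f z)) (hf : MDifferentiableAt (𝓡 4) (𝓡 4) f z) :
    modelDeriv (g ∘ f) z = (modelDeriv g (f z)).comp (modelDeriv f z) := by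
  ext1 v
  exact mfderiv_comp_apply (I' := 𝓡 4) z hg hf v

omit [IsManifold (𝓡 4) ∞ M] [IsManifold (𝓡 4) ∞ N] in
theorem modelDeriv_symm_comp (Φ : PartialDiffeomorph (𝓡 4) (𝓡 4) M N ∞) {z : M}
    (hz : z ∈ Φ.source) :
    (modelDeriv Φ.symm (Φ z)).comp (modelDeriv Φ z) = LinearMap.id := by
  have h1 : MDifferentiableAt (𝓡 4) (𝓡 4) Φ.symm (Φ z) :=
    Φ.symm.mdifferentiableAt (by simp) (Φ.map_source hz)
  rw [← modelDeriv_comp h1 (Φ.mdifferentiableAt (by simp) hz)]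
  have h2 : Φ.symm ∘ Φ =ᶠ[𝓝 z] id := by
    filter_upwards [Φ.open_source.mem_nhds hz] with w hw
    exact Φ.left_inv hw
  ext1 v
  have h3 := h2.mfderiv_eq (I := 𝓡 4) (I' := 𝓡 4)
  exact (congrArg (fun B : EuclideanSpace ℝ (Fin 4) →L[ℝ] EuclideanSpace ℝ (Fin 4) => B v) h3).trans
    (by rw [mfderiv_id]; rfl)

omit [IsManifold (𝓡 4) ∞ M] [IsManifold (𝓡 4) ∞ N] in
theorem CarriesAt.symm {Φ : PartialDiffeomorph (𝓡 4) (𝓡 4) M N ∞} {S : TangentField M}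
    {T : TangentField N} {z : M} (hz : z ∈ Φ.source) (h : CarriesAt Φ S T z) :
    CarriesAt Φ.symm T S (Φ z) := by
  have h1 : Φ.symm (Φ z) = z := Φ.left_inv hz
  rw [CarriesAt, h1, ← show _ = modelField T (Φ z) from h, ← Submodule.map_comp,
    modelDeriv_symm_comp Φ hz, Submodule.map_id]

omit [IsManifold (𝓡 4) ∞ M] [IsManifold (𝓡 4) ∞ N] [IsManifold (𝓡 4) ∞ P] in
theorem CarriesAt.trans {Φ : PartialDiffeomorph (𝓡 4) (𝓡 4) M N ∞}
    {Ψ : PartialDiffeomorph (𝓡 4) (𝓡 4) N P ∞} {S : TangentField M}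
    {T : TangentField N} {R : TangentField P} {z : M} (hz : z ∈ Φ.source) (hz' : Φ z ∈ Ψ.source)
    (h : CarriesAt Φ S T z) (h' : CarriesAt Ψ T R (Φ z)) :
    CarriesAt (Φ.trans Ψ) S R z := by
  have h1 : modelDeriv (Φ.trans Ψ) z = (modelDeriv Ψ (Φ z)).comp (modelDeriv Φ z) :=
    modelDeriv_comp (f := Φ) (g := Ψ) (Ψ.mdifferentiableAt (by simp) hz')
      (Φ.mdifferentiableAt (by simp) hz)
  rw [CarriesAt, h1, Submodule.map_comp, show _ = modelField T (Φ z) from h]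
  exact h'

theorem TangentFiltration.LocallyIsomorphicAt.symm {F : TangentFiltration M}
    {G : TangentFiltration N} {x : M} {y : N} (h : F.LocallyIsomorphicAt G x y) :
    G.LocallyIsomorphicAt F y x := by
  obtain ⟨Φ, hx, rfl, hΦ⟩ := locallyIsomorphicAt_iff.1 h
  refine locallyIsomorphicAt_iff.2 ⟨Φ.symm, Φ.map_source hx, Φ.left_inv hx, fun z hz => ?_⟩
  obtain ⟨w, hw, rfl⟩ : ∃ w ∈ Φ.source, Φ w = z := ⟨Φ.symm z, Φ.map_target hz, Φ.right_inv hz⟩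
  obtain ⟨h1, h2, h3, h4⟩ := hΦ w hw
  exact ⟨h1.symm hw, h2.symm hw, h3.symm hw, h4.symm hw⟩

theorem TangentFiltration.LocallyIsomorphicAt.trans {F : TangentFiltration M}
    {G : TangentFiltration N} {H : TangentFiltration P} {x : M} {y : N} {z : P}
    (h : F.LocallyIsomorphicAt G x y) (h' : G.LocallyIsomorphicAt H y z) :
    F.LocallyIsomorphicAt H x z := by
  obtain ⟨Φ, hx, rfl, hΦ⟩ := locallyIsomorphicAt_iff.1 h
  obtain ⟨Ψ, hy, rfl, hΨ⟩ := locallyIsomorphicAt_iff.1 h'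
  refine locallyIsomorphicAt_iff.2 ⟨Φ.trans Ψ, ⟨hx, hy⟩, rfl, fun w hw => ?_⟩
  obtain ⟨hw1, hw2⟩ : w ∈ Φ.source ∧ Φ w ∈ Ψ.source := hw
  obtain ⟨h1, h2, h3, h4⟩ := hΦ w hw1
  obtain ⟨k1, k2, k3, k4⟩ := hΨ (Φ w) hw2
  exact ⟨h1.trans hw1 hw2 k1, h2.trans hw1 hw2 k2, h3.trans hw1 hw2 k3, h4.trans hw1 hw2 k4⟩

end LocalIsomorphism

/-! ### Passage from Engel charts to J². -/

section NormalForm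

variable {M : Type*} [TopologicalSpace M] [ChartedSpace (EuclideanSpace ℝ (Fin 4)) M]
  [IsManifold (𝓡 4) ∞ M]
  {N : Type*} [TopologicalSpace N] [ChartedSpace (EuclideanSpace ℝ (Fin 4)) N]
  [IsManifold (𝓡 4) ∞ N]

omit [IsManifold (𝓡 4) ∞ M] [IsManifold (𝓡 4) ∞ N] in
theorem carriesAt_top (Φ : PartialDiffeomorph (𝓡 4) (𝓡 4) M N ∞) {z : M} (hz : z ∈ Φ.source) :
    CarriesAt Φ (fun _ => ⊤) (fun _ => ⊤) z := by
  have h1 : Function.Injective (modelDeriv Φ z) :=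
    Function.LeftInverse.injective (g := modelDeriv Φ.symm (Φ z))
      fun v => congrArg (fun B : _ →ₗ[ℝ] EuclideanSpace ℝ (Fin 4) => B v) (modelDeriv_symm_comp Φ hz)
  change Submodule.map (modelDeriv Φ z) ⊤ = ⊤
  rw [Submodule.map_top, LinearMap.range_eq_top]
  exact LinearMap.injective_iff_surjective.1 h1

/-- The chart at `x`, as a partial diffeomorphism. -/
noncomputable def chartDiffeomorph (x : M) :
    PartialDiffeomorph (𝓡 4) (𝓡 4) M (EuclideanSpace ℝ (Fin 4)) ∞ where
  toPartialEquiv := extChartAt (𝓡 4) x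
  open_source := isOpen_extChartAt_source x
  open_target := isOpen_extChartAt_target x
  contMDiffOn_toFun := by simpa using contMDiffOn_extChartAt (I := 𝓡 4) (n := ∞) (x := x)
  contMDiffOn_invFun := contMDiffOn_extChartAt_symm x

/-- The chart carries the span of vector fields to the span of their expressions in the chart. -/
theorem carriesAt_chartDiffeomorph (x : M) {ι : Type*} {s : ι → VField M} {T : TangentField M}
    {z : EuclideanSpace ℝ (Fin 4)} (hz : z ∈ (extChartAt (𝓡 4) x).target)
    (hT : Submodule.span ℝ (Set.range fun i => s i ((extChartAt (𝓡 4) x).symm z)) =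
      T ((extChartAt (𝓡 4) x).symm z)) :
    CarriesAt (chartDiffeomorph x) T
      (fun u => Submodule.span ℝ (Set.range fun i => chartField x (s i) u))
      ((extChartAt (𝓡 4) x).symm z) := by
  have h1 : chartDiffeomorph x ((extChartAt (𝓡 4) x).symm z) = z :=
    (extChartAt (𝓡 4) x).right_inv hz
  rw [CarriesAt, h1, modelField, ← hT]
  change Submodule.map (chartDeriv x ((extChartAt (𝓡 4) x).symm z)) _ = _
  rw [Submodule.map_span, ← Set.range_comp]
  have h2 : (chartDeriv x ((extChartAt (𝓡 4) x).symm z)) ∘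
      (fun i => s i ((extChartAt (𝓡 4) x).symm z)) = fun i => chartField x (s i) z :=
    funext fun i => chartDeriv_apply x hz (s i)
  rw [h2]
  rfl

/-- An injective derivative preserves the rank, so mapping the frame into `T` already forces
equality. -/
theorem carriesAt_span {f : EuclideanSpace ℝ (Fin 4) → EuclideanSpace ℝ (Fin 4)} {k : ℕ}
    {v : Fin k → EuclideanSpace ℝ (Fin 4) → EuclideanSpace ℝ (Fin 4)}
    {T : TangentField JetTwo} {z : EuclideanSpace ℝ (Fin 4)} (hT : IsSmoothSubbundle T k)
    (hv : LinearIndependent ℝ fun i => v i z) (hf : Function.Injective (fderiv ℝ f z))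
    (hvT : ∀ i, fderiv ℝ f z (v i z) ∈ modelField T (f z)) :
    CarriesAt (N := JetTwo) f
      (fun u => Submodule.span ℝ (Set.range fun i => v i u)) T z := by
  have h1 : modelDeriv (N := JetTwo) f z = (fderiv ℝ f z).toLinearMap := by
    ext1 w
    exact congrArg
      (fun B : EuclideanSpace ℝ (Fin 4) →L[ℝ] EuclideanSpace ℝ (Fin 4) => B w) mfderiv_eq_fderiv
  rw [CarriesAt, h1]
  change Submodule.map _ (Submodule.span ℝ (Set.range fun i => v i z)) = _
  rw [Submodule.map_span, ← Set.range_comp]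
  exact span_range_eq_of_finrank (hv.map' _ (LinearMap.ker_eq_bot.2 hf)) hvT (hT.finrank_eq (f z))

/-- The Engel normal form at given points. -/
theorem TangentFiltration.BracketConditions.locallyIsomorphicAt_canonical [T2Space M]
    {F : TangentFiltration M} (hF : F.BracketConditions) (x : M) (w : JetTwo) :
    F.LocallyIsomorphicAt JetTwo.canonicalFiltration x w := by
  obtain ⟨s, ⟨h0, h1, h2, hli⟩, X, Y, P, Q, hch⟩ := hF.exists_isEngelChart x
  obtain ⟨X, Y, P, Q, hch, hX, hY, hP, hQ⟩ := hch.exists_shift (w 0) (w 1) (w 2) (w 3)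
  have hs : ∀ i, SmoothVFieldOn (s i) Set.univ := by
    intro i; fin_cases i <;> [exact h0.1; exact h1.1; exact h2.1]
  have h02 := mem_smoothSections_of_le F.le12 h0
  have h03 := mem_smoothSections_of_le F.le23 h02
  have h13 := mem_smoothSections_of_le F.le23 h1
  have sp1 := eventually_span_frame x hs hli (by norm_num) F.smooth1
    (by intro i; fin_cases i; exact h0.2)
  have sp2 := eventually_span_frame x hs hli (by norm_num) F.smooth2
    (by intro i; fin_cases i <;> [exact h02.2; exact h1.2])
  have sp3 := eventually_span_frame x hs hli le_rfl F.smooth3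
    (by intro i; fin_cases i <;> [exact h03.2; exact h13.2; exact h2.2])
  have hind := eventually_linearIndependent_chartField x hs hli
  have htar := eventually_mem_chart_target x
  set m := extChartAt (𝓡 4) x x with hm
  let f : EuclideanSpace ℝ (Fin 4) → EuclideanSpace ℝ (Fin 4) := fun z => !₂[X z, Y z, P z, Q z]
  have hfm : f m = w := by
    ext i
    fin_cases i <;> [exact hX; exact hY; exact hP; exact hQ]
  have hfs : ∀ᶠ z in 𝓝 m, ContDiffAt ℝ ∞ f z := by
    filter_upwards [hch.smooth_x, hch.smooth_y, hch.smooth_p, hch.smooth_q] with z k0 k1 k2 k3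
    rw [contDiffAt_euclidean]
    intro i
    fin_cases i <;> [exact k0; exact k1; exact k2; exact k3]
  have hfd : ∀ z, ContDiffAt ℝ ∞ f z → ∀ v, fderiv ℝ f z v 0 = fderiv ℝ X z v ∧
      fderiv ℝ f z v 1 = fderiv ℝ Y z v ∧ fderiv ℝ f z v 2 = fderiv ℝ P z v ∧
      fderiv ℝ f z v 3 = fderiv ℝ Q z v := by
    intro z hz v
    have key : ∀ i, fderiv ℝ (fun u => f u i) z v = fderiv ℝ f z v i := by
      intro i
      have k := ((EuclideanSpace.proj (𝕜 := ℝ) i).hasFDerivAt.comp z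
        (hz.differentiableAt (by simp)).hasFDerivAt).fderiv
      exact congrArg (fun B : EuclideanSpace ℝ (Fin 4) →L[ℝ] ℝ => B v) k
    exact ⟨(key 0).symm, (key 1).symm, (key 2).symm, (key 3).symm⟩
  have hinj : Function.Injective (fderiv ℝ f m).toLinearMap := by
    rw [injective_iff_map_eq_zero]
    intro v hv
    obtain ⟨k0, k1, k2, k3⟩ := hfd m hfs.self_of_nhds v
    have hv' : fderiv ℝ f m v = 0 := hv
    rw [hv'] at k0 k1 k2 k3
    exact hch.inj v k0.symm k1.symm k2.symm k3.symm
  let A := (LinearEquiv.ofInjectiveEndo _ hinj).toContinuousLinearEquiv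
  have hA : HasFDerivAt f (A : EuclideanSpace ℝ (Fin 4) →L[ℝ] EuclideanSpace ℝ (Fin 4)) m :=
    (hfs.self_of_nhds.differentiableAt (by simp)).hasFDerivAt
  obtain ⟨g, hmg, hgf, hgs, hgd, hgi⟩ := exists_smooth_localInverse hfs hA
  -- One open set on which all the germ identities hold at once; the diffeomorphism is restricted to
  -- it because the flag must be preserved at every point of its source.
  obtain ⟨O, hO, hOo, hmO⟩ := eventually_nhds_iff.1
    (htar.and (hind.and (sp1.and (sp2.and (sp3.and (hch.x₁.and (hch.y₁.and (hch.p₁.and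
      (hch.y₂.and (hch.p₂.and hch.y₃))))))))))
  let G : PartialDiffeomorph (𝓡 4) (𝓡 4) (EuclideanSpace ℝ (Fin 4)) JetTwo ∞ :=
    { toPartialEquiv := (g.restrOpen O hOo).toPartialEquiv
      open_source := (g.restrOpen O hOo).open_source
      open_target := (g.restrOpen O hOo).open_target
      contMDiffOn_toFun := fun z hz => by
        have : ContDiffAt ℝ ∞ g z := by
          rw [show (g : _ → EuclideanSpace ℝ (Fin 4)) = f from funext hgf]; exact hgs z hz.1
        exact this.contMDiffAt.contMDiffWithinAt
      contMDiffOn_invFun := fun z hz => (hgi z hz.1).contMDiffAt.contMDiffWithinAt }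
  have hGf : (G : EuclideanSpace ℝ (Fin 4) → JetTwo) = f := funext hgf
  have hGs : ∀ z, z ∈ G.source ↔ z ∈ g.source ∧ z ∈ O := fun z => Iff.rfl
  refine locallyIsomorphicAt_iff.2 ⟨(chartDiffeomorph x).trans G,
    ⟨mem_extChartAt_source x, hmg, hmO⟩, (hgf m).trans hfm, fun y hy => ?_⟩
  obtain ⟨hy1, hy2⟩ : y ∈ (extChartAt (𝓡 4) x).source ∧ extChartAt (𝓡 4) x y ∈ G.source := hy
  obtain ⟨z, hz, rfl⟩ : ∃ z ∈ (extChartAt (𝓡 4) x).target, (extChartAt (𝓡 4) x).symm z = y :=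
    ⟨_, (extChartAt (𝓡 4) x).map_source hy1, (extChartAt (𝓡 4) x).left_inv hy1⟩
  have hzc : chartDiffeomorph x ((extChartAt (𝓡 4) x).symm z) = z :=
    (extChartAt (𝓡 4) x).right_inv hz
  rw [(extChartAt (𝓡 4) x).right_inv hz] at hy2
  obtain ⟨hzg, hzO⟩ := (hGs z).1 hy2
  obtain ⟨-, kind, k1, k2, k3, kx1, ky1, kp1, ky2, kp2, ky3⟩ := hO z hzO
  have hfz := hfd z (hgs z hzg)
  have hinjz : Function.Injective (fderiv ℝ f z) := by
    obtain ⟨B, hB⟩ := hgd z hzg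
    rw [hB.fderiv]
    exact B.injective
  have hy2' : chartDiffeomorph x ((extChartAt (𝓡 4) x).symm z) ∈ G.source := by rwa [hzc]
  have hcan : ∀ {T : TangentField M} {S : TangentField JetTwo} {k : ℕ} (hk : k ≤ 3),
      Submodule.span ℝ (Set.range fun i : Fin k =>
        s (i.castLE hk) ((extChartAt (𝓡 4) x).symm z)) = T ((extChartAt (𝓡 4) x).symm z) →
      IsSmoothSubbundle S k →
      (∀ i : Fin k, fderiv ℝ f z (chartField x (s (i.castLE hk)) z) ∈ modelField S (f z)) →
      CarriesAt ((chartDiffeomorph x).trans G) T S ((extChartAt (𝓡 4) x).symm z) := by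
    intro T S k hk hT hS hmem
    refine (carriesAt_chartDiffeomorph x hz hT).trans hy1 hy2' ?_
    rw [hzc, hGf]
    exact carriesAt_span hS (kind.comp (Fin.castLE hk) (Fin.castLE_injective hk)) hinjz hmem
  have m1 : fderiv ℝ f z (chartField x (s 0) z) ∈ modelField JetTwo.vertical (f z) := by
    obtain ⟨a0, a1, a2, -⟩ := hfz (chartField x (s 0) z)
    exact (JetTwo.mem_vertical _ _).2 ⟨a0.trans kx1, a1.trans ky1, a2.trans kp1⟩
  have m2 : ∀ i : Fin 2, fderiv ℝ f z (chartField x (s (i.castLE (by norm_num))) z) ∈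
      modelField JetTwo.tautological (f z) := by
    intro i
    fin_cases i
    · exact JetTwo.canonicalFiltration.le12 _ m1
    · obtain ⟨a0, a1, a2, -⟩ := hfz (chartField x (s 1) z)
      refine (JetTwo.mem_tautological _ _).2 ⟨a1.trans ?_, a2.trans ?_⟩
      · exact ky2.trans (congrArg (P z * ·) a0.symm)
      · exact kp2.trans (congrArg (Q z * ·) a0.symm)
  refine ⟨hcan (by norm_num) k1 JetTwo.smooth_vertical ?_,
    hcan (by norm_num) k2 JetTwo.smooth_tautological m2,
    hcan le_rfl k3 JetTwo.smooth_contact ?_, carriesAt_top _ ⟨hy1, hy2'⟩⟩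
  · intro i
    fin_cases i
    exact m1
  · intro i
    fin_cases i
    · exact JetTwo.canonicalFiltration.le23 _ (m2 0)
    · exact JetTwo.canonicalFiltration.le23 _ (m2 1)
    · obtain ⟨a0, a1, -, -⟩ := hfz (chartField x (s 2) z)
      exact (JetTwo.mem_contact _ _).2 (a1.trans (ky3.trans (congrArg (P z * ·) a0.symm)))

end NormalForm

theorem mainTheorem9 (M : Type*) [TopologicalSpace M] [T2Space M]
    [ChartedSpace (EuclideanSpace ℝ (Fin 4)) M] [IsManifold (𝓡 4) ∞ M]
    (F : TangentFiltration M) (hF : F.BracketConditions) :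
    F.LocallyIsomorphic JetTwo.canonicalFiltration ∧
    ∀ (N : Type*) [TopologicalSpace N] [T2Space N]
      [ChartedSpace (EuclideanSpace ℝ (Fin 4)) N] [IsManifold (𝓡 4) ∞ N]
      (G : TangentFiltration N), G.BracketConditions → F.LocallyIsomorphic G :=
  ⟨fun x w => hF.locallyIsomorphicAt_canonical x w, fun _ _ _ _ _ _ hG x y =>
    -- Any point of J² would do as the intermediate one.
    (hF.locallyIsomorphicAt_canonical x 0).trans (hG.locallyIsomorphicAt_canonical y 0).symm⟩
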